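/- Let $\mathfrak g$ be a real nilpotent Lie algebra of finite even dimension, with descending central series $\mathfrak g^0=\mathfrak g$, $\mathfrak g^i=[\mathfrak g^{i-1},\mathfrak g]$, and nilindex $m$ (the least integer with $\mathfrak g^m=0$). Suppose that $\mathfrak g$ is quasi-filiform, i.e. $m=\dim\mathfrak g-2$, and of the form $t_r$ for an integer $r$ with $3\le r\le m$, i.e. for $1\le i\le m$ the quotient $\mathfrak g^{i-1}/\mathfrak g^{i}$ has dimension $2$ if $i\in\{1,r\}$ and dimension $1$ otherwise. Let $V_i\subset\mathfrak g^*$ be the annihilator of $\mathfrak g^i$; the nilpotency degree $\mathrm{nil}(\theta)$ of a complex $1$-form $\theta\in\mathfrak g^*\otimes\mathbb C$ is the least $i$ with $\theta\in V_i\otimes\mathbb C$. Let $\mathcal J$ be a generalized complex structure on $\mathfrak g$: a linear endomorphism of $\mathfrak g\oplus\mathfrak g^*$ with $\mathcal J^2=-\mathrm{Id}$, orthogonal for $\langle X+\xi,Y+\eta\rangle=\frac12(\xi(Y)+\eta(X))$, whose $+i$-eigenspace $L\subset(\mathfrak g\oplus\mathfrak g^*)\otimes\mathbb C$ is closed under the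 ($\mathbb C$-bilinear) Courant bracket $[X+\xi,Y+\eta]_c=[X,Y]+\mathcal L_X\eta-\mathcal L_Y\xi-\frac12 d(i_X\eta-i_Y\xi)$. Let $k$ be its type, i.e. the codimension of the projection of $L$ in $\mathfrak g\otimes\mathbb C$. Complex $1$-forms $\theta_1,\dots,\theta_k$ are said to be associated with $\mathcal J$ if there are real $2$-forms $B,\omega$ on $\mathfrak g$ such that the spinor $\rho=\theta_1\wedge\dots\wedge\theta_k\wedge e^{B+i\omega}$ satisfies $L=\{X+\xi : i_X\rho+\xi\wedge\rho=0\}$. They are called appropriate if $\mathrm{nil}(\theta_i)\le\mathrm{nil}(\theta_j)$ for $i<j$ and, for every $i$, the forms $\theta_j$ with $\mathrm{nil}(\theta_j)>i$ are linearly independent modulo $V_i\otimes\mathbb C$. Then there are appropriate forms $\theta_1,\dots,\theta_k$ associated with $\mathcal J$ whose nilpotency degrees $(\mathrm{nil}(\theta_1),\dots,\mathrm{nil}(\theta_k))$ are the first $k$ terms of one of the two sequences $$(1,\ r,\ r+1,\ r+2,\ \dots),\qquad (1,\ r,\ r,\ r+1,\ r+2,\ \dots),$$ that is, $(1,r,r+1,\dots,r+k-2)$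 or $(1,r,r,r+1,\dots,r+k-3)$. Moreover, if some forms $\theta_1,\dots,\theta_k$ associated with $\mathcal J$ have the nilpotency degrees of the second sequence, then $k<r$. -/

import Mathlib

open scoped TensorProduct

noncomputable section

namespace GenComplex

/-! ### Nilpotent Lie algebras: nilindex, the graded pieces, quasi-filiform algebras -/

section Nilpotent

variable (g : Type*) [LieRing g] [LieAlgebra ℝ g]

/-- The descending central series `g⁰ = g`, `gⁱ = [gⁱ⁻¹, g]`, as real subspaces of `g`. -/
def centralSeries (i : ℕ) : Submodule ℝ g :=
  (LieModule.lowerCentralSeries ℝ g g i).toSubmodule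

/-- The nilindex of `g`: the least `m` such that `gᵐ = 0`. -/
def nilindex : ℕ := sInf {m : ℕ | centralSeries g m = ⊥}

/-- The dimension of `gⁱ / gⁱ⁺¹`, the piece `W_{i+1}` of the associated graded algebra. -/
def gradedDim (i : ℕ) : ℕ :=
  Module.finrank ℝ
    (centralSeries g i ⧸ (centralSeries g (i + 1)).submoduleOf (centralSeries g i))

/-- A nilpotent Lie algebra is quasi-filiform if its nilindex is `dim g - 2`. -/
def IsQuasiFiliform : Prop :=
  LieRing.IsNilpotent g ∧ nilindex g + 2 = Module.finrank ℝ g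

/-- `g` is of the form `{p 1, …, p m}`, where `m` is its nilindex: `dim W_i = p i`. -/
def IsOfForm (p : ℕ → ℕ) : Prop :=
  ∀ i : ℕ, i < nilindex g → gradedDim g i = p (i + 1)

/-- `g` is of the form `t_r` with `2 ≤ r ≤ m`: the spaces `W_1` and `W_r` have dimension `2`,
the other ones have dimension `1`. -/
def IsOfFormT (r : ℕ) : Prop :=
  2 ≤ r ∧ r ≤ nilindex g ∧ IsOfForm g (fun i => if i = 1 ∨ i = r then 2 else 1)

end Nilpotent

/-! ### The space `h ⊕ h*` of a Lie algebra `h` -/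

section Double

variable (R h : Type*) [CommRing R] [LieRing h] [LieAlgebra R h]

/-- The space `h ⊕ h*`. -/
abbrev Double : Type _ := h × Module.Dual R h

variable {R h}

/-- The Lie derivative of a 1-form, `(𝓛_X η)(Y) = dη(X, Y) = -η([X, Y])`. -/
def lieDeriv (X : h) (η : Module.Dual R h) : Module.Dual R h :=
  -(η ∘ₗ (LieAlgebra.ad R h X))

/-- The Courant bracket
`[X + ξ, Y + η]_c = [X, Y] + 𝓛_X η - 𝓛_Y ξ - ½ d(i_X η - i_Y ξ)`; its last term is zero, because
`i_X η - i_Y ξ` is a constant (a form of degree `0`). -/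
def courant (u v : Double R h) : Double R h :=
  (⁅u.1, v.1⁆, lieDeriv u.1 v.2 - lieDeriv v.1 u.2)

/-- The Clifford action `(X + ξ) ∘ ρ = i_X ρ + ξ ∧ ρ` of `h ⊕ h*` on the forms `⋀ h*`, as a linear
map in `X + ξ` for a given form `ρ`. -/
def clifford (ρ : ExteriorAlgebra R (Module.Dual R h)) :
    Double R h →ₗ[R] ExteriorAlgebra R (Module.Dual R h) :=
  (CliffordAlgebra.contractLeft.flip ρ ∘ₗ Module.Dual.eval R h) ∘ₗ LinearMap.fst R _ _ +
    (LinearMap.mulRight R ρ ∘ₗ ExteriorAlgebra.ι R) ∘ₗ LinearMap.snd R _ _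

/-- `L_ρ = {X + ξ | (X + ξ) ∘ ρ = 0}`. -/
def spinorAnnihilator (ρ : ExteriorAlgebra R (Module.Dual R h)) : Submodule R (Double R h) :=
  LinearMap.ker (clifford ρ)

end Double

section Complex

variable {g : Type*} [LieRing g] [LieAlgebra ℝ g]

/-- The scalar product `⟨X + ξ, Y + η⟩ = ½ (ξ(Y) + η(X))` on `g ⊕ g*`. -/
def pairing (u v : Double ℝ g) : ℝ := (1 / 2) * (u.2 v.1 + v.2 u.1)

/-! ### Complexification -/

variable (g) in
/-- The complexification of `g`, a complex Lie algebra. -/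
abbrev Cx : Type _ := ℂ ⊗[ℝ] g

variable (g) in
/-- The complex 1-forms on `g`, i.e. the `ℂ`-linear forms on the complexification. -/
abbrev CxForm : Type _ := Module.Dual ℂ (Cx g)

variable (g) in
/-- The inclusion of the real 1-forms into the complex 1-forms, by `ℂ`-linear extension. -/
def formToCx : Module.Dual ℝ g →ₗ[ℝ] CxForm g := Module.Dual.baseChange ℂ

variable (g) in
/-- The inclusion `X + ξ ↦ 1 ⊗ X + ξ_ℂ` of `g ⊕ g*` into the double of the complexification. -/
def doubleToCx : Double ℝ g →ₗ[ℝ] Double ℂ (Cx g) :=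
  ((TensorProduct.mk ℝ ℂ g 1) ∘ₗ LinearMap.fst ℝ _ _).prod
    (formToCx g ∘ₗ LinearMap.snd ℝ _ _)

variable (g) in
/-- The inclusion of the real forms (of all degrees) into the complex forms. -/
def formsToCx :
    ExteriorAlgebra ℝ (Module.Dual ℝ g) →ₐ[ℝ] ExteriorAlgebra ℂ (CxForm g) :=
  ExteriorAlgebra.lift ℝ
    ⟨((ExteriorAlgebra.ι ℂ (M := CxForm g)).restrictScalars ℝ) ∘ₗ formToCx g,
      fun _ => ExteriorAlgebra.ι_sq_zero _⟩

/-! ### Generalized complex structures -/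

/-- The `+i`-eigenspace of an endomorphism of `g ⊕ g*`, inside the complexification of
`g ⊕ g*`, which is identified with the double of the complexification of `g`. -/
def eigenL (J : Double ℝ g →ₗ[ℝ] Double ℝ g) : Submodule ℂ (Double ℂ (Cx g)) :=
  (Module.End.eigenspace (J.baseChange ℂ) Complex.I).map
    (LinearMap.liftBaseChange ℂ (doubleToCx g))

variable (g) in
/-- A generalized complex structure on `g`. -/
structure GeneralizedComplexStructure where
  /-- The endomorphism of `g ⊕ g*`. -/
  J : Double ℝ g →ₗ[ℝ] Double ℝ g
  sq_eq : ∀ u, J (J u) = -u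
  orthogonal : ∀ u v, pairing (J u) (J v) = pairing u v
  involutive : ∀ u ∈ eigenL J, ∀ v ∈ eigenL J, courant u v ∈ eigenL J

namespace GeneralizedComplexStructure

/-- The `+i`-eigenspace `L`. -/
def L (𝒥 : GeneralizedComplexStructure g) : Submodule ℂ (Double ℂ (Cx g)) := eigenL 𝒥.J

/-- The type: the (complex) codimension of the projection of `L` to the complexification
of `g`. -/
def type (𝒥 : GeneralizedComplexStructure g) : ℕ :=
  Module.finrank ℂ (Cx g ⧸ 𝒥.L.map (LinearMap.fst ℂ (Cx g) (CxForm g)))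

/-- The complex 1-forms `θ₁, …, θ_k` are associated with the generalized complex structure:
for some real 2-forms `B` and `ω`, its `+i`-eigenspace is `L_ρ` for the spinor
`ρ = θ₁ ∧ ⋯ ∧ θ_k ∧ exp (B + i ω)` (2-forms are nilpotent in the exterior algebra). -/
def IsAssociated (𝒥 : GeneralizedComplexStructure g) {k : ℕ} (θ : Fin k → CxForm g) : Prop :=
  ∃ B ∈ ⋀[ℝ]^2 (Module.Dual ℝ g), ∃ ω ∈ ⋀[ℝ]^2 (Module.Dual ℝ g),
    spinorAnnihilator (ExteriorAlgebra.ιMulti ℂ k θ *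
      IsNilpotent.exp (formsToCx g B + Complex.I • formsToCx g ω)) = 𝒥.L

end GeneralizedComplexStructure

/-! ### Nilpotency degrees -/

variable (g) in
/-- The complexification of `V_i`, the space of the 1-forms on `g` that vanish on `gⁱ`. -/
def V (i : ℕ) : Submodule ℂ (CxForm g) :=
  Submodule.span ℂ (formToCx g '' (centralSeries g i).dualAnnihilator)

/-- The nilpotency degree of a complex 1-form: the least `i` such that it belongs to `V_i`. -/
def nilDegree (θ : CxForm g) : ℕ := sInf {i : ℕ | θ ∈ V g i}

/-- The conditions on a decomposition `Ω = θ₁ ∧ ⋯ ∧ θ_k` to be appropriate: the nilpotency degrees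
are non-decreasing, and for all `i` the `θ_j` with `nil θ_j > i` are linearly independent
modulo `V_i`. -/
def IsAppropriate {k : ℕ} (θ : Fin k → CxForm g) : Prop :=
  (∀ i j, i < j → nilDegree (θ i) ≤ nilDegree (θ j)) ∧
  ∀ i : ℕ, LinearIndependent ℂ
    (fun j : {j : Fin k // i < nilDegree (θ j)} => (V g i).mkQ (θ j.1))

/-- The sequence `1, r, r + 1, r + 2, …`; its first `k` terms end in `r + k - 2` if `2 ≤ k`. -/
def firstDegrees (r : ℕ) : ℕ → ℕ
  | 0 => 1
  | i + 1 => r + i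

/-- The sequence `1, r, r, r + 1, …`; its first `k` terms end in `r + k - 3` if `3 ≤ k`. -/
def secondDegrees (r : ℕ) : ℕ → ℕ
  | 0 => 1
  | 1 => r
  | i + 2 => r + i

end Complex

end GenComplex

end

/-!
The projection `E` of `L` to the complexification of `g` is a subalgebra, and `E` and its complex
conjugate span. Any basis of the annihilator of `E` is associated with the generalized complex
structure: the pairing on the isotropic space `L` is an alternating form on `E`, and extending it to
the complexification of `g` gives the exponent `B + i ω`.

Let `d i` be the dimension of the space of the forms in `V_i` that vanish on `E`, that is, the
codimension of `E + gⁱ`. Comparing `E + gⁱ` with its conjugate gives `2 d i ≤ dim g - dim gⁱ`. If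
`d (i + 1) = d i`, i.e. `gⁱ ⊆ E + gⁱ⁺¹`, and `gⁱ⁺¹ / gⁱ⁺²` is at most a line, then
`gⁱ⁺¹ ⊆ E + gⁱ⁺²`: as `gⁱ⁺¹` is real and generated by brackets with `E` and its conjugate, either
one such bracket lies in `E` or its conjugate and spans that line, or `gⁱ⁺¹ = gⁱ⁺²`. So for an
algebra of the form `t_r` the sequence `d` is `1` below `r` (or zero throughout), jumps by at most
`2` at `r`, and then grows by `1` until it reaches `k`. The jumps of `d` are the nilpotency degrees
of a basis adapted to the filtration. For the second sequence the inequality at the last degree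
`r + k - 3` bounds `k`.
-/

noncomputable section

namespace GenComplex

section ExteriorAlgebra

open ExteriorAlgebra (ι ιMulti)

variable {R M : Type*} [CommRing R] [AddCommGroup M] [Module R M]

/-- The interior product of a vector `d` of `M*` with the forms in `⋀ M`, i.e. the left
contraction of the Clifford algebra of the quadratic form `0`. -/
def interiorProduct (d : Module.Dual R M) : ExteriorAlgebra R M →ₗ[R] ExteriorAlgebra R M :=
  CliffordAlgebra.contractLeft (Q := 0) d

lemma interiorProduct_one (d : Module.Dual R M) : interiorProduct d 1 = 0 :=
  CliffordAlgebra.contractLeft_one (Q := 0) d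

lemma interiorProduct_ι (d : Module.Dual R M) (a : M) :
    interiorProduct d (ι R a) = algebraMap R _ (d a) :=
  CliffordAlgebra.contractLeft_ι (Q := 0) d a

lemma interiorProduct_ι_mul (d : Module.Dual R M) (a : M) (x : ExteriorAlgebra R M) :
    interiorProduct d (ι R a * x) = d a • x - ι R a * interiorProduct d x :=
  CliffordAlgebra.contractLeft_ι_mul d a x

lemma interiorProduct_comm (d d' : Module.Dual R M) (x : ExteriorAlgebra R M) :
    interiorProduct d (interiorProduct d' x) = -interiorProduct d' (interiorProduct d x) :=
  CliffordAlgebra.contractLeft_comm d d' x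

lemma interiorProduct_ιMulti_eq_zero {d : Module.Dual R M} {k : ℕ} {θ : Fin k → M}
    (hd : ∀ j, d (θ j) = 0) : interiorProduct d (ιMulti R k θ) = 0 := by
  induction k with
  | zero => rw [ExteriorAlgebra.ιMulti_zero_apply, interiorProduct_one]
  | succ k ih =>
    rw [ExteriorAlgebra.ιMulti_succ_apply, interiorProduct_ι_mul, hd,
      zero_smul, ih (θ := Matrix.vecTail θ) fun j => hd j.succ, mul_zero, sub_zero]

lemma ι_mul_ιMulti_eq_zero {k : ℕ} {θ : Fin k → M} {ξ : M}
    (hξ : ξ ∈ Submodule.span R (Set.range θ)) : ι R ξ * ιMulti R k θ = 0 := by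
  suffices Submodule.span R (Set.range θ) ≤
      LinearMap.ker (LinearMap.mulRight R (ιMulti R k θ) ∘ₗ ι R) from this hξ
  rw [Submodule.span_le]
  rintro _ ⟨j, rfl⟩
  simpa only [SetLike.mem_coe, LinearMap.mem_ker, LinearMap.comp_apply, LinearMap.mulRight_apply,
    ExteriorAlgebra.ιMulti_apply] using ExteriorAlgebra.ι_mul_prod_list θ j

lemma ιMulti_ne_zero {K E : Type*} [Field K] [AddCommGroup E] [Module K E] {k : ℕ} {θ : Fin k → E}
    (hθ : LinearIndependent K θ) : ιMulti K k θ ≠ 0 := by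
  intro h
  refine (exteriorPower.ιMulti_family_linearIndependent_field (n := k) hθ).ne_zero
    (Set.powersetCard.ofFinEmbEquiv (OrderIso.refl (Fin k)).toOrderEmbedding) (Subtype.ext ?_)
  rwa [exteriorPower.ιMulti_family_apply_coe, ExteriorAlgebra.ιMulti_family,
    Equiv.symm_apply_apply]

lemma ι_mul_ι_mem_exteriorPower (a b : M) : ι R a * ι R b ∈ ⋀[R]^2 M := by
  rw [ExteriorAlgebra.exteriorPower, pow_two]
  exact Submodule.mul_mem_mul ⟨a, rfl⟩ ⟨b, rfl⟩

@[elab_as_elim]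
lemma exteriorPower_two_induction {p : (y : ExteriorAlgebra R M) → y ∈ ⋀[R]^2 M → Prop}
    (ι_mul_ι : ∀ a b : M, p (ι R a * ι R b) (ι_mul_ι_mem_exteriorPower a b))
    (add : ∀ x hx y hy, p x hx → p y hy → p (x + y) (add_mem hx hy))
    {y : ExteriorAlgebra R M} (hy : y ∈ ⋀[R]^2 M) : p y hy := by
  suffices ∃ hy, p y hy from this.2
  rw [ExteriorAlgebra.exteriorPower, pow_two] at hy
  refine Submodule.mul_induction_on hy ?_ fun x y ⟨_, hx⟩ ⟨_, hy⟩ => ⟨_, add _ _ _ _ hx hy⟩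
  rintro _ ⟨a, rfl⟩ _ ⟨b, rfl⟩
  exact ⟨_, ι_mul_ι a b⟩

lemma ι_mul_ι_swap (a b : M) : ι R a * ι R b = -(ι R b * ι R a) :=
  eq_neg_of_add_eq_zero_left (ExteriorAlgebra.ι_add_mul_swap a b)

lemma commute_of_mem_exteriorPower_two {y : ExteriorAlgebra R M} (hy : y ∈ ⋀[R]^2 M)
    (x : ExteriorAlgebra R M) : Commute y x := by
  induction hy using exteriorPower_two_induction with
  | add y _ z _ ihy ihz => exact ihy.add_left ihz
  | ι_mul_ι a b =>
    induction x using ExteriorAlgebra.induction with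
    | algebraMap r => exact Algebra.commute_algebraMap_right r _
    | ι c =>
      calc ι R a * ι R b * ι R c = -(ι R a * ι R c) * ι R b := by
            rw [mul_assoc, ι_mul_ι_swap b c, mul_neg, neg_mul, mul_assoc]
        _ = ι R c * (ι R a * ι R b) := by rw [ι_mul_ι_swap a c, neg_neg, mul_assoc]
    | mul x y hx hy => exact hx.mul_right hy
    | add x y hx hy => exact hx.add_right hy

lemma isNilpotent_of_mem_exteriorPower_two {y : ExteriorAlgebra R M} (hy : y ∈ ⋀[R]^2 M) :
    IsNilpotent y := by
  induction hy using exteriorPower_two_induction with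
  | add y hy z _ ihy ihz => exact (commute_of_mem_exteriorPower_two hy z).isNilpotent_add ihy ihz
  | ι_mul_ι a b =>
    have hcomm := commute_of_mem_exteriorPower_two (ι_mul_ι_mem_exteriorPower (R := R) a b)
    refine ⟨2, ?_⟩
    rw [pow_two, ← mul_assoc, (hcomm (ι R a)).eq, ← mul_assoc, ExteriorAlgebra.ι_sq_zero,
      zero_mul, zero_mul]

lemma interiorProduct_mul_of_mem_exteriorPower_two (d : Module.Dual R M) {y : ExteriorAlgebra R M}
    (hy : y ∈ ⋀[R]^2 M) (x : ExteriorAlgebra R M) :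
    interiorProduct d (y * x) = interiorProduct d y * x + y * interiorProduct d x := by
  induction hy using exteriorPower_two_induction with
  | add y hy z hz ihy ihz => rw [add_mul, map_add, ihy, ihz, map_add, add_mul, add_mul]; abel
  | ι_mul_ι a b =>
    simp only [mul_assoc, interiorProduct_ι_mul, interiorProduct_ι, mul_sub, sub_mul,
      smul_mul_assoc, mul_smul_comm, ← Algebra.commutes, ← Algebra.smul_def]
    abel

end ExteriorAlgebra

section Exponential

variable {A : Type*} [Ring A]

lemma map_pow_succ_mul_of_leibniz {D : A →+ A} {y : A} (hcomm : Commute y (D y))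
    (hD : ∀ x, D (y * x) = D y * x + y * D x) (n : ℕ) (x : A) :
    D (y ^ (n + 1) * x) = (n + 1) • (y ^ n * (D y * x)) + y ^ (n + 1) * D x := by
  induction n generalizing x with
  | zero => simp [hD]
  | succ n ih =>
    rw [pow_succ y (n + 1), mul_assoc, ih, hD, mul_add, ← mul_assoc (D y), ← hcomm.eq,
      mul_assoc y (D y), ← mul_assoc (y ^ n), ← pow_succ, ← mul_assoc _ y, succ_nsmul _ (n + 1)]
    abel

lemma commute_exp_of_commute [Module ℚ A] {a x : A} (ha : IsNilpotent a) (h : Commute a x) :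
    Commute (IsNilpotent.exp a) x := by
  obtain ⟨N, hN⟩ := ha
  rw [IsNilpotent.exp_eq_sum hN]
  exact Commute.sum_left _ _ _ fun n _ => (h.pow_left n).smul_left _

lemma map_exp_mul_of_leibniz [Module ℚ A] {D : A →+ A} {y : A} (hy : IsNilpotent y)
    (hcomm : Commute y (D y)) (hD : ∀ x, D (y * x) = D y * x + y * D x) (x : A) :
    D (IsNilpotent.exp y * x) = IsNilpotent.exp y * (D y * x + D x) := by
  obtain ⟨N, hN⟩ := hy
  have hN' : y ^ (N + 1) = 0 := by rw [pow_succ, hN, zero_mul]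
  have hterm (n : ℕ) : D (((n + 1).factorial : ℚ)⁻¹ • (y ^ (n + 1) * x)) =
      (n.factorial : ℚ)⁻¹ • (y ^ n * (D y * x)) +
        ((n + 1).factorial : ℚ)⁻¹ • (y ^ (n + 1) * D x) := by
    rw [map_rat_smul, map_pow_succ_mul_of_leibniz hcomm hD, smul_add,
      ← Nat.cast_smul_eq_nsmul ℚ, smul_smul, Nat.factorial_succ, Nat.cast_mul, mul_inv_rev,
      inv_mul_cancel_right₀ (Nat.cast_ne_zero.2 n.succ_ne_zero)]
  calc D (IsNilpotent.exp y * x)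
      = ∑ n ∈ Finset.range (N + 1), D ((n.factorial : ℚ)⁻¹ • (y ^ n * x)) := by
        simp only [IsNilpotent.exp_eq_sum hN', Finset.sum_mul, smul_mul_assoc, map_sum]
    _ = ∑ n ∈ Finset.range N, (n.factorial : ℚ)⁻¹ • (y ^ n * (D y * x)) +
        ∑ n ∈ Finset.range (N + 1), (n.factorial : ℚ)⁻¹ • (y ^ n * D x) := by
        rw [Finset.sum_range_succ', Finset.sum_range_succ']
        simp only [hterm, Finset.sum_add_distrib, Nat.factorial_zero, Nat.cast_one, inv_one,
          one_smul, pow_zero, one_mul, add_assoc]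
    _ = IsNilpotent.exp y * (D y * x) + IsNilpotent.exp y * D x := by
        nth_rewrite 1 [IsNilpotent.exp_eq_sum hN]
        simp only [IsNilpotent.exp_eq_sum hN', Finset.sum_mul, smul_mul_assoc]
    _ = IsNilpotent.exp y * (D y * x + D x) := (mul_add _ _ _).symm

end Exponential

section NaturalPairing

variable {R W : Type*} [CommRing R] [AddCommGroup W] [Module R W]

variable (R W) in
/-- The symmetric bilinear form `(X + ξ, Y + η) ↦ ξ(Y) + η(X)` on `W ⊕ W*`, which is twice the
scalar product `pairing` when both are defined. -/
def naturalPairing : LinearMap.BilinForm R (W × Module.Dual R W) :=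
  (LinearMap.dualProd R W).compl₁₂ (LinearEquiv.prodComm R W (Module.Dual R W)).toLinearMap
    (LinearEquiv.prodComm R W (Module.Dual R W)).toLinearMap

lemma naturalPairing_apply (u v : W × Module.Dual R W) :
    naturalPairing R W u v = v.2 u.1 + u.2 v.1 := rfl

lemma naturalPairing_isSymm : (naturalPairing R W).IsSymm :=
  ⟨fun _ _ => add_comm _ _⟩

lemma naturalPairing_separatingLeft {K W : Type*} [Field K] [AddCommGroup W] [Module K W] :
    (naturalPairing K W).SeparatingLeft := by
  rintro ⟨X, ξ⟩ h
  refine Prod.ext ?_ (LinearMap.ext fun Y => by simpa [naturalPairing_apply] using h (Y, 0))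
  exact (Module.forall_dual_apply_eq_zero_iff K X).1 fun η => by
    simpa [naturalPairing_apply] using h (0, η)

lemma orthogonal_eq_self_of_sup_eq_top {V : Type*} [AddCommGroup V] [Module R V]
    {B : LinearMap.BilinForm R V} (hB : B.IsSymm) (hsep : B.SeparatingLeft) {P Q : Submodule R V}
    (hP : P ≤ B.orthogonal P) (hQ : Q ≤ B.orthogonal Q) (hPQ : P ⊔ Q = ⊤) :
    B.orthogonal P = P := by
  refine le_antisymm (fun v hv => ?_) hP
  obtain ⟨p, hp, q, hq, rfl⟩ := Submodule.mem_sup.1 (hPQ ▸ Submodule.mem_top : v ∈ P ⊔ Q)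
  suffices q = 0 by rwa [this, add_zero]
  have hqP : q ∈ B.orthogonal P := by simpa using sub_mem hv (hP hp)
  refine hsep q fun w => ?_
  obtain ⟨p', hp', q', hq', rfl⟩ := Submodule.mem_sup.1 (hPQ ▸ Submodule.mem_top : w ∈ P ⊔ Q)
  have hqp' : B q p' = 0 := hB.isRefl _ _ (hqP p' hp')
  have hqq' : B q q' = 0 := hB.isRefl _ _ (hQ hq q' hq')
  rw [map_add, hqp', hqq', add_zero]

lemma zero_mk_mem_iff_of_orthogonal_eq_self {L : Submodule R (W × Module.Dual R W)}
    (hL : (naturalPairing R W).orthogonal L = L) (ξ : Module.Dual R W) :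
    (0, ξ) ∈ L ↔ ξ ∈ (L.map (LinearMap.fst R W _)).dualAnnihilator := by
  conv_lhs => rw [← hL]
  simp [LinearMap.BilinForm.mem_orthogonal_iff, naturalPairing_apply,
    Submodule.mem_dualAnnihilator]

lemma exists_isAlt_of_orthogonal_eq_self {K W : Type*} [Field K] [NeZero (2 : K)]
    [AddCommGroup W] [Module K W] {L : Submodule K (W × Module.Dual K W)}
    (hL : (naturalPairing K W).orthogonal L = L) :
    ∃ A : LinearMap.BilinForm K W, A.IsAlt ∧ ∀ X ∈ L.map (LinearMap.fst K W _), (X, A X) ∈ L := by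
  set E := L.map (LinearMap.fst K W _)
  obtain ⟨C, hC⟩ := E.exists_isCompl
  let p : W →ₗ[K] E := E.projectionOnto C hC
  have hp (X : E) : p X = X := Submodule.projectionOnto_apply_left hC X
  obtain ⟨s, hs⟩ := ((LinearMap.fst K W _).submoduleMap L).exists_rightInverse_of_surjective
    (LinearMap.range_eq_top.2 (LinearMap.submoduleMap_surjective _ _))
  have hs_fst (X : E) : (s X).1.1 = X := congrArg Subtype.val (LinearMap.congr_fun hs X)
  let A : LinearMap.BilinForm K W :=
    LinearMap.lcomp K K (E.subtype ∘ₗ p) ∘ₗ LinearMap.snd K _ _ ∘ₗ L.subtype ∘ₗ s ∘ₗ p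
  have hA (X Y : W) : A X Y = (s (p X)).1.2 (p Y) := rfl
  refine ⟨A, fun X => ?_, fun X hX => ?_⟩
  · have h : (naturalPairing K W) (s (p X)).1 (s (p X)).1 = 0 :=
      hL.ge (s (p X)).2 _ (s (p X)).2
    rw [naturalPairing_apply, hs_fst, ← two_mul] at h
    exact (mul_eq_zero.1 h).resolve_left two_ne_zero
  · have hdiff : (0, A X - (s ⟨X, hX⟩).1.2) ∈ L := by
      rw [zero_mk_mem_iff_of_orthogonal_eq_self hL, Submodule.mem_dualAnnihilator]
      intro Y hY
      rw [LinearMap.sub_apply, hA, hp ⟨X, hX⟩, hp ⟨Y, hY⟩, sub_self]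
    convert add_mem (s ⟨X, hX⟩).2 hdiff using 1
    exact Prod.ext (by simp [hs_fst]) (by simp)

end NaturalPairing

section TwoFormOfBilinForm

open ExteriorAlgebra (ι)

lemma exists_interiorProduct_eq_of_isAlt {R W : Type*} [CommRing R] [Invertible (2 : R)]
    [AddCommGroup W] [Module R W] [Module.Free R W] [Module.Finite R W]
    {A : LinearMap.BilinForm R W} (hA : A.IsAlt) :
    ∃ σ ∈ ⋀[R]^2 (Module.Dual R W),
      ∀ X, interiorProduct (Module.Dual.eval R W X) σ = ι R (A X) := by
  let b := Module.Free.chooseBasis R W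
  refine ⟨⅟(2 : R) • ∑ i, ι R (b.coord i) * ι R (A (b i)), Submodule.smul_mem _ _ <|
    sum_mem fun i _ => ι_mul_ι_mem_exteriorPower _ _, fun X => ?_⟩
  have hX : ∑ i, b.coord i X • b i = X := b.sum_repr X
  have hAX : ∑ i, A (b i) X • b.coord i = -A X := by
    refine b.ext fun j => ?_
    simpa [LinearMap.sum_apply, Finsupp.single_apply] using
      (LinearMap.BilinForm.IsAlt.neg_eq hA X (b j)).symm
  have hterm (i) : interiorProduct (Module.Dual.eval R W X) (ι R (b.coord i) * ι R (A (b i))) =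
      ι R (b.coord i X • A (b i)) - ι R (A (b i) X • b.coord i) := by
    rw [interiorProduct_ι_mul, interiorProduct_ι, ← Algebra.commutes, ← Algebra.smul_def,
      Module.Dual.eval_apply, Module.Dual.eval_apply, map_smul, map_smul]
  calc interiorProduct (Module.Dual.eval R W X) (⅟(2 : R) • ∑ i, ι R (b.coord i) * ι R (A (b i)))
      = ⅟(2 : R) • (ι R (A (∑ i, b.coord i X • b i)) - ι R (∑ i, A (b i) X • b.coord i)) := by
        simp only [map_smul, map_sum, hterm, Finset.sum_sub_distrib]
    _ = ⅟(2 : R) • (2 : R) • ι R (A X) := by rw [hX, hAX, map_neg, sub_neg_eq_add, two_smul]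
    _ = ι R (A X) := invOf_smul_smul _ _

end TwoFormOfBilinForm

section Spinor

open ExteriorAlgebra (ι ιMulti)

variable {R h : Type*} [CommRing R] [LieRing h] [LieAlgebra R h]

lemma clifford_apply (ρ : ExteriorAlgebra R (Module.Dual R h)) (u : Double R h) :
    clifford ρ u = interiorProduct (Module.Dual.eval R h u.1) ρ + ι R u.2 * ρ := rfl

lemma clifford_clifford_add_swap (ρ : ExteriorAlgebra R (Module.Dual R h)) (u v : Double R h) :
    clifford (clifford ρ v) u + clifford (clifford ρ u) v = naturalPairing R h u v • ρ := by
  simp only [clifford_apply, naturalPairing_apply, map_add, mul_add, interiorProduct_ι_mul,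
    interiorProduct_comm (Module.Dual.eval R h u.1), ← mul_assoc, ι_mul_ι_swap u.2, neg_mul,
    add_smul, Module.Dual.eval_apply]
  abel

lemma spinorAnnihilator_le_orthogonal {K h : Type*} [Field K] [LieRing h] [LieAlgebra K h]
    {ρ : ExteriorAlgebra K (Module.Dual K h)} (hρ : ρ ≠ 0) :
    spinorAnnihilator ρ ≤ (naturalPairing K h).orthogonal (spinorAnnihilator ρ) := by
  intro u hu v hv
  have h := clifford_clifford_add_swap ρ v u
  rw [LinearMap.mem_ker.1 hu, LinearMap.mem_ker.1 hv, clifford_apply, clifford_apply] at h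
  simpa [hρ] using h.symm

lemma clifford_mul_exp [Module ℚ (ExteriorAlgebra R (Module.Dual R h))]
    (Ω : ExteriorAlgebra R (Module.Dual R h)) {σ : ExteriorAlgebra R (Module.Dual R h)}
    (hσ : σ ∈ ⋀[R]^2 (Module.Dual R h)) (u : Double R h) :
    clifford (Ω * IsNilpotent.exp σ) u = IsNilpotent.exp σ *
      (interiorProduct (Module.Dual.eval R h u.1) Ω +
        (interiorProduct (Module.Dual.eval R h u.1) σ + ι R u.2) * Ω) := by
  have hexp (x) : Commute (IsNilpotent.exp σ) x :=
    commute_exp_of_commute (isNilpotent_of_mem_exteriorPower_two hσ)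
      (commute_of_mem_exteriorPower_two hσ x)
  have hleibniz : interiorProduct (Module.Dual.eval R h u.1) (IsNilpotent.exp σ * Ω) =
      IsNilpotent.exp σ * (interiorProduct (Module.Dual.eval R h u.1) σ * Ω +
        interiorProduct (Module.Dual.eval R h u.1) Ω) :=
    map_exp_mul_of_leibniz (D := (interiorProduct (Module.Dual.eval R h u.1)).toAddMonoidHom)
      (isNilpotent_of_mem_exteriorPower_two hσ) (commute_of_mem_exteriorPower_two hσ _)
      (interiorProduct_mul_of_mem_exteriorPower_two _ hσ) Ω
  rw [← (hexp Ω).eq, clifford_apply, hleibniz, ← mul_assoc, ← (hexp (ι R u.2)).eq, mul_assoc,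
    ← mul_add, add_mul]
  abel_nf

lemma mem_spinorAnnihilator_mul_exp_iff [Module ℚ (ExteriorAlgebra R (Module.Dual R h))]
    {Ω σ : ExteriorAlgebra R (Module.Dual R h)} (hσ : σ ∈ ⋀[R]^2 (Module.Dual R h))
    {u : Double R h} : u ∈ spinorAnnihilator (Ω * IsNilpotent.exp σ) ↔
      interiorProduct (Module.Dual.eval R h u.1) Ω +
        (interiorProduct (Module.Dual.eval R h u.1) σ + ι R u.2) * Ω = 0 := by
  rw [spinorAnnihilator, LinearMap.mem_ker, clifford_mul_exp Ω hσ]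
  exact (IsNilpotent.isUnit_exp (isNilpotent_of_mem_exteriorPower_two hσ)).mul_right_eq_zero

variable {K : Type*} [Field K] [LieAlgebra K h]
  [Module ℚ (ExteriorAlgebra K (Module.Dual K h))]

lemma spinorAnnihilator_ιMulti_mul_exp_eq {L : Submodule K (Double K h)}
    (hL : (naturalPairing K h).orthogonal L = L) {k : ℕ} {θ : Fin k → Module.Dual K h}
    (hθ : LinearIndependent K θ)
    (hspan : Submodule.span K (Set.range θ) = (L.map (LinearMap.fst K h _)).dualAnnihilator)
    {A : LinearMap.BilinForm K h} (hA : ∀ X ∈ L.map (LinearMap.fst K h _), (X, A X) ∈ L)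
    {σ : ExteriorAlgebra K (Module.Dual K h)} (hσ : σ ∈ ⋀[K]^2 (Module.Dual K h))
    (hAσ : ∀ X, interiorProduct (Module.Dual.eval K h X) σ = ι K (-A X)) :
    spinorAnnihilator (ιMulti K k θ * IsNilpotent.exp σ) = L := by
  have hρ : ιMulti K k θ * IsNilpotent.exp σ ≠ 0 := fun h0 => ιMulti_ne_zero hθ <|
    (IsNilpotent.isUnit_exp (isNilpotent_of_mem_exteriorPower_two hσ)).mul_left_eq_zero.1 h0
  have hle : L ≤ spinorAnnihilator (ιMulti K k θ * IsNilpotent.exp σ) := by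
    rintro ⟨X, ξ⟩ hX
    have hXE : X ∈ L.map (LinearMap.fst K h _) := ⟨_, hX, rfl⟩
    have hθX (j : Fin k) : Module.Dual.eval K h X (θ j) = 0 :=
      (Submodule.mem_dualAnnihilator _).1 (hspan ▸ Submodule.subset_span ⟨j, rfl⟩) X hXE
    have hξ : -A X + ξ ∈ Submodule.span K (Set.range θ) := by
      rw [hspan, ← zero_mk_mem_iff_of_orthogonal_eq_self hL]
      simpa [neg_add_eq_sub] using sub_mem hX (hA X hXE)
    rw [mem_spinorAnnihilator_mul_exp_iff hσ, hAσ, interiorProduct_ιMulti_eq_zero hθX, zero_add,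
      ← map_add, ι_mul_ιMulti_eq_zero hξ]
  refine le_antisymm ?_ hle
  calc _ ≤ (naturalPairing K h).orthogonal (spinorAnnihilator _) :=
        spinorAnnihilator_le_orthogonal hρ
    _ ≤ (naturalPairing K h).orthogonal L := LinearMap.BilinForm.orthogonal_le hle
    _ = L := hL

theorem exists_spinorAnnihilator_ιMulti_mul_exp_eq [CharZero K] [FiniteDimensional K h]
    {L : Submodule K (Double K h)} (hL : (naturalPairing K h).orthogonal L = L) {k : ℕ}
    {θ : Fin k → Module.Dual K h} (hθ : LinearIndependent K θ)
    (hspan : Submodule.span K (Set.range θ) = (L.map (LinearMap.fst K h _)).dualAnnihilator) :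
    ∃ σ ∈ ⋀[K]^2 (Module.Dual K h),
      spinorAnnihilator (ιMulti K k θ * IsNilpotent.exp σ) = L := by
  obtain ⟨A, hA, hAL⟩ := exists_isAlt_of_orthogonal_eq_self hL
  have := invertibleOfNonzero (two_ne_zero (α := K))
  obtain ⟨σ, hσ, hAσ⟩ := exists_interiorProduct_eq_of_isAlt hA.neg
  exact ⟨σ, hσ, spinorAnnihilator_ιMulti_mul_exp_eq hL hθ hspan hAL hσ hAσ⟩

end Spinor

section Eigenspaces

lemma eigenspace_sup_eigenspace_neg_eq_top {R N : Type*} [CommRing R] [Invertible (2 : R)]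
    [AddCommGroup N] [Module R N] {T : Module.End R N} (hT : ∀ x, T (T x) = -x) {i : R}
    (hi : i * i = -1) : T.eigenspace i ⊔ T.eigenspace (-i) = ⊤ := by
  have hii (x : N) : i • i • x = -x := by rw [smul_smul, hi, neg_one_smul]
  refine eq_top_iff.2 fun x _ => Submodule.mem_sup.2
    ⟨⅟(2 : R) • (x - i • T x), Submodule.smul_mem _ _ ?_, ⅟(2 : R) • (x + i • T x),
      Submodule.smul_mem _ _ ?_, ?_⟩
  · rw [Module.End.mem_eigenspace_iff, map_sub, map_smul, hT, smul_sub, hii, smul_neg]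
    abel
  · rw [Module.End.mem_eigenspace_iff, map_add, map_smul, hT, smul_add, neg_smul, neg_smul, hii,
      smul_neg]
    abel
  · rw [← smul_add, sub_add_add_cancel, ← two_smul R, invOf_smul_smul]

end Eigenspaces

section Conjugation

variable {M N : Type*} [AddCommGroup M] [Module ℝ M] [AddCommGroup N] [Module ℝ N]

variable (M) in
/-- Complex conjugation on the complexification of a real vector space. -/
def complexConj : ℂ ⊗[ℝ] M →ₛₗ[starRingEnd ℂ] ℂ ⊗[ℝ] M where
  __ := LinearMap.rTensor M Complex.conjAe.toLinearMap
  map_smul' z w := by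
    change LinearMap.rTensor M _ (z • w) = starRingEnd ℂ z • LinearMap.rTensor M _ w
    induction w using TensorProduct.induction_on with
    | zero => simp
    | tmul c x => simp [TensorProduct.smul_tmul']
    | add w w' hw hw' => rw [smul_add, map_add, hw, hw', map_add, smul_add]

@[simp]
lemma complexConj_tmul (z : ℂ) (x : M) : complexConj M (z ⊗ₜ x) = starRingEnd ℂ z ⊗ₜ x := rfl

@[simp]
lemma complexConj_complexConj (w : ℂ ⊗[ℝ] M) : complexConj M (complexConj M w) = w := by
  induction w using TensorProduct.induction_on with
  | zero => simp
  | tmul z x => simp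
  | add w w' hw hw' => rw [map_add, map_add, hw, hw']

lemma complexConj_baseChange (f : M →ₗ[ℝ] N) (w : ℂ ⊗[ℝ] M) :
    complexConj N (f.baseChange ℂ w) = f.baseChange ℂ (complexConj M w) := by
  induction w using TensorProduct.induction_on with
  | zero => simp
  | tmul z x => simp
  | add w w' hw hw' => rw [map_add, map_add, map_add, map_add, hw, hw']

lemma complexConj_mem_eigenspace {f : Module.End ℝ M} {μ : ℂ} {w : ℂ ⊗[ℝ] M}
    (hw : w ∈ Module.End.eigenspace (f.baseChange ℂ) μ) :
    complexConj M w ∈ Module.End.eigenspace (f.baseChange ℂ) (starRingEnd ℂ μ) := by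
  rw [Module.End.mem_eigenspace_iff] at hw ⊢
  rw [← complexConj_baseChange, hw, map_smulₛₗ]

lemma complexConj_mem_baseChange (P : Submodule ℝ M) {w : ℂ ⊗[ℝ] M}
    (hw : w ∈ P.baseChange ℂ) : complexConj M w ∈ P.baseChange ℂ := by
  obtain ⟨w, rfl⟩ := hw
  exact ⟨complexConj P w, (complexConj_baseChange _ _).symm⟩

lemma finrank_comap_complexConj (P : Submodule ℂ (ℂ ⊗[ℝ] M)) :
    Module.finrank ℂ (P.comap (complexConj M)) = Module.finrank ℂ P := by
  let e : P.comap (complexConj M) ≃+ P :=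
    { toFun := fun w => ⟨complexConj M w, w.2⟩
      invFun := fun w => ⟨complexConj M w, by
        rw [Submodule.mem_comap, complexConj_complexConj]; exact w.2⟩
      left_inv := fun w => Subtype.ext (complexConj_complexConj _)
      right_inv := fun w => Subtype.ext (complexConj_complexConj _)
      map_add' := fun w w' => Subtype.ext (map_add _ _ _) }
  exact congrArg Cardinal.toNat (rank_eq_of_equiv_equiv (starRingEnd ℂ) e
    (starRingAut (R := ℂ)).bijective fun z w => Subtype.ext (map_smulₛₗ (complexConj M) z w.1))

lemma finrank_add_finrank_le_two_mul [FiniteDimensional ℝ M] {P A : Submodule ℂ (ℂ ⊗[ℝ] M)}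
    (hP : P ⊔ P.comap (complexConj M) = ⊤) (hA : A ≤ P ⊓ P.comap (complexConj M)) :
    Module.finrank ℝ M + Module.finrank ℂ A ≤ 2 * Module.finrank ℂ P := by
  have hdim := Submodule.finrank_sup_add_finrank_inf_eq P (P.comap (complexConj M))
  rw [hP, finrank_top, Module.finrank_baseChange, finrank_comap_complexConj] at hdim
  have hle := Submodule.finrank_mono hA
  omega

end Conjugation

section Complexification

variable {g : Type*} [LieRing g] [LieAlgebra ℝ g]

lemma formToCx_tmul (α : Module.Dual ℝ g) (z : ℂ) (x : g) :
    formToCx g α (z ⊗ₜ x) = z * (α x : ℂ) := by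
  simp [formToCx, mul_comm]

lemma complexConj_lie (X Y : Cx g) : complexConj g ⁅X, Y⁆ = ⁅complexConj g X, complexConj g Y⁆ := by
  change complexConj g (LieAlgebra.ad ℂ (Cx g) X Y) =
    LieAlgebra.ad ℂ (Cx g) (complexConj g X) (complexConj g Y)
  induction X using TensorProduct.induction_on with
  | zero => simp only [map_zero, LinearMap.zero_apply]
  | add X X' hX hX' => simp only [map_add, LinearMap.add_apply, hX, hX']
  | tmul w x =>
    induction Y using TensorProduct.induction_on with
    | zero => simp only [map_zero]
    | add Y Y' hY hY' => simp only [map_add, hY, hY']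
    | tmul z y => simp [LieAlgebra.ExtendScalars.bracket_tmul]

lemma exists_formToCx_add_I_smul (θ : CxForm g) :
    ∃ α β : Module.Dual ℝ g, θ = formToCx g α + Complex.I • formToCx g β := by
  let t : g →ₗ[ℝ] ℂ := θ.restrictScalars ℝ ∘ₗ TensorProduct.mk ℝ ℂ g 1
  refine ⟨Complex.reLm ∘ₗ t, Complex.imLm ∘ₗ t, ?_⟩
  ext x
  simp [formToCx_tmul, t, mul_comm Complex.I, Complex.re_add_im]

lemma liftBaseChange_doubleToCx_surjective :
    Function.Surjective (LinearMap.liftBaseChange ℂ (doubleToCx g)) := by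
  let Φ := LinearMap.liftBaseChange ℂ (doubleToCx g)
  have vector_mem (X : Cx g) : (X, 0) ∈ LinearMap.range Φ := by
    induction X using TensorProduct.induction_on with
    | zero => exact zero_mem _
    | tmul z x => exact ⟨z ⊗ₜ (x, 0), by simp [Φ, doubleToCx, TensorProduct.smul_tmul']⟩
    | add X Y hX hY => simpa using add_mem hX hY
  have form_mem (α : Module.Dual ℝ g) : (0, formToCx g α) ∈ LinearMap.range Φ :=
    ⟨1 ⊗ₜ (0, α), by simp [Φ, doubleToCx]⟩
  rintro ⟨X, θ⟩
  obtain ⟨α, β, rfl⟩ := exists_formToCx_add_I_smul θ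
  simpa using add_mem (vector_mem X)
    (add_mem (form_mem α) (Submodule.smul_mem _ Complex.I (form_mem β)))

lemma fst_liftBaseChange_doubleToCx (w : ℂ ⊗[ℝ] Double ℝ g) :
    (LinearMap.liftBaseChange ℂ (doubleToCx g) w).1 = (LinearMap.fst ℝ g _).baseChange ℂ w := by
  induction w using TensorProduct.induction_on with
  | zero => simp
  | tmul z x => simp [doubleToCx, TensorProduct.smul_tmul']
  | add w w' hw hw' => rw [map_add, Prod.fst_add, hw, hw', map_add]

lemma naturalPairing_doubleToCx (a b : Double ℝ g) :
    naturalPairing ℂ (Cx g) (doubleToCx g a) (doubleToCx g b) = (2 * pairing a b : ℝ) := by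
  simp [naturalPairing_apply, doubleToCx, formToCx_tmul, pairing]
  ring

lemma formsToCx_ι (α : Module.Dual ℝ g) :
    formsToCx g (ExteriorAlgebra.ι ℝ α) = ExteriorAlgebra.ι ℂ (formToCx g α) :=
  ExteriorAlgebra.lift_ι_apply ℝ _ _ α

lemma exists_formsToCx_add_I_smul {σ : ExteriorAlgebra ℂ (CxForm g)}
    (hσ : σ ∈ ⋀[ℂ]^2 (CxForm g)) : ∃ B ∈ ⋀[ℝ]^2 (Module.Dual ℝ g),
      ∃ ω ∈ ⋀[ℝ]^2 (Module.Dual ℝ g), σ = formsToCx g B + Complex.I • formsToCx g ω := by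
  induction hσ using exteriorPower_two_induction with
  | add x hx y hy ihx ihy =>
    obtain ⟨B, hB, ω, hω, rfl⟩ := ihx
    obtain ⟨B', hB', ω', hω', rfl⟩ := ihy
    refine ⟨B + B', add_mem hB hB', ω + ω', add_mem hω hω', ?_⟩
    rw [map_add, map_add, smul_add, add_add_add_comm]
  | ι_mul_ι a b =>
    obtain ⟨α, β, rfl⟩ := exists_formToCx_add_I_smul a
    obtain ⟨α', β', rfl⟩ := exists_formToCx_add_I_smul b
    refine ⟨_, sub_mem (ι_mul_ι_mem_exteriorPower α α') (ι_mul_ι_mem_exteriorPower β β'), _,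
      add_mem (ι_mul_ι_mem_exteriorPower α β') (ι_mul_ι_mem_exteriorPower β α'), ?_⟩
    simp only [map_add, map_sub, map_mul, map_smul, formsToCx_ι, add_mul, mul_add, smul_mul_assoc,
      mul_smul_comm, smul_add, smul_smul, Complex.I_mul_I, neg_one_smul]
    abel

end Complexification

namespace GeneralizedComplexStructure

variable {g : Type*} [LieRing g] [LieAlgebra ℝ g] (𝒥 : GeneralizedComplexStructure g)

lemma baseChange_J_apply_self (w : ℂ ⊗[ℝ] Double ℝ g) :
    𝒥.J.baseChange ℂ (𝒥.J.baseChange ℂ w) = -w := by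
  have hJJ : 𝒥.J ∘ₗ 𝒥.J = -LinearMap.id := LinearMap.ext 𝒥.sq_eq
  rw [← LinearMap.comp_apply, ← LinearMap.baseChange_comp, hJJ, LinearMap.baseChange_neg,
    LinearMap.baseChange_id, LinearMap.neg_apply, LinearMap.id_apply]

lemma eigenspace_sup_eigenspace_neg_eq_top : Module.End.eigenspace (𝒥.J.baseChange ℂ) Complex.I ⊔
    Module.End.eigenspace (𝒥.J.baseChange ℂ) (-Complex.I) = ⊤ :=
  have := invertibleOfNonzero (two_ne_zero (α := ℂ))
  GenComplex.eigenspace_sup_eigenspace_neg_eq_top 𝒥.baseChange_J_apply_self Complex.I_mul_I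

lemma naturalPairing_baseChange_J (w w' : ℂ ⊗[ℝ] Double ℝ g) :
    naturalPairing ℂ (Cx g) (LinearMap.liftBaseChange ℂ (doubleToCx g) (𝒥.J.baseChange ℂ w))
      (LinearMap.liftBaseChange ℂ (doubleToCx g) (𝒥.J.baseChange ℂ w')) =
    naturalPairing ℂ (Cx g) (LinearMap.liftBaseChange ℂ (doubleToCx g) w)
      (LinearMap.liftBaseChange ℂ (doubleToCx g) w') := by
  induction w using TensorProduct.induction_on with
  | zero => simp
  | add v v' hv hv' => simp only [map_add, LinearMap.add_apply, hv, hv']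
  | tmul z a =>
    induction w' using TensorProduct.induction_on with
    | zero => simp
    | add v v' hv hv' => simp only [map_add, hv, hv']
    | tmul z' b =>
      simp only [LinearMap.baseChange_tmul, LinearMap.liftBaseChange_tmul, map_smul,
        LinearMap.smul_apply, naturalPairing_doubleToCx, 𝒥.orthogonal]

lemma map_eigenspace_le_orthogonal {μ : ℂ} (hμ : μ * μ = -1) :
    (Module.End.eigenspace (𝒥.J.baseChange ℂ) μ).map (LinearMap.liftBaseChange ℂ (doubleToCx g)) ≤
      (naturalPairing ℂ (Cx g)).orthogonal ((Module.End.eigenspace (𝒥.J.baseChange ℂ) μ).map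
        (LinearMap.liftBaseChange ℂ (doubleToCx g))) := by
  rintro _ ⟨v, hv, rfl⟩ _ ⟨w, hw, rfl⟩
  have h := 𝒥.naturalPairing_baseChange_J w v
  rw [Module.End.mem_eigenspace_iff.1 hv, Module.End.mem_eigenspace_iff.1 hw] at h
  simp only [map_smul, LinearMap.smul_apply, smul_smul, hμ, neg_one_smul] at h
  exact self_eq_neg.1 h.symm

lemma orthogonal_L : (naturalPairing ℂ (Cx g)).orthogonal 𝒥.L = 𝒥.L := by
  refine orthogonal_eq_self_of_sup_eq_top naturalPairing_isSymm naturalPairing_separatingLeft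
    (𝒥.map_eigenspace_le_orthogonal Complex.I_mul_I)
    (𝒥.map_eigenspace_le_orthogonal (μ := -Complex.I) (by rw [neg_mul_neg, Complex.I_mul_I])) ?_
  rw [L, eigenL, ← Submodule.map_sup, 𝒥.eigenspace_sup_eigenspace_neg_eq_top, Submodule.map_top,
    LinearMap.range_eq_top.2 liftBaseChange_doubleToCx_surjective]

end GeneralizedComplexStructure

section Complexification

variable {g : Type*} [LieRing g] [LieAlgebra ℝ g]

/-- The complex conjugate of a subalgebra of the complexification of `g`, encoded as its preimage
under complex conjugation, which is an involution. -/
def conjSubalgebra (F : LieSubalgebra ℂ (Cx g)) : LieSubalgebra ℂ (Cx g) where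
  __ := F.toSubmodule.comap (complexConj g)
  lie_mem' {X Y} hX hY := by
    change complexConj g ⁅X, Y⁆ ∈ F
    rw [complexConj_lie]
    exact F.lie_mem hX hY

lemma mem_conjSubalgebra {F : LieSubalgebra ℂ (Cx g)} {X : Cx g} :
    X ∈ conjSubalgebra F ↔ complexConj g X ∈ F := Iff.rfl

@[simp]
lemma conjSubalgebra_conjSubalgebra (F : LieSubalgebra ℂ (Cx g)) :
    conjSubalgebra (conjSubalgebra F) = F :=
  SetLike.ext fun X => by rw [mem_conjSubalgebra, mem_conjSubalgebra, complexConj_complexConj]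

end Complexification

namespace GeneralizedComplexStructure

variable {g : Type*} [LieRing g] [LieAlgebra ℝ g]

/-- The projection `E` of `L` to the complexification of `g`. It is a subalgebra because `L` is
closed under the Courant bracket. -/
def E (𝒥 : GeneralizedComplexStructure g) : LieSubalgebra ℂ (Cx g) where
  __ := 𝒥.L.map (LinearMap.fst ℂ (Cx g) (CxForm g))
  lie_mem' := by
    rintro _ _ ⟨u, hu, rfl⟩ ⟨v, hv, rfl⟩
    exact ⟨_, 𝒥.involutive u hu v hv, rfl⟩

lemma E_sup_conjSubalgebra_E (𝒥 : GeneralizedComplexStructure g) :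
    𝒥.E.toSubmodule ⊔ (conjSubalgebra 𝒥.E).toSubmodule = ⊤ := by
  have mem_E {w : ℂ ⊗[ℝ] Double ℝ g}
      (hw : w ∈ Module.End.eigenspace (𝒥.J.baseChange ℂ) Complex.I) :
      (LinearMap.fst ℝ g _).baseChange ℂ w ∈ 𝒥.E :=
    ⟨_, Submodule.mem_map_of_mem hw, fst_liftBaseChange_doubleToCx w⟩
  refine eq_top_iff.2 fun X _ => ?_
  obtain ⟨w, rfl⟩ := LinearMap.baseChange_surjective ℂ
    (LinearMap.fst_surjective (R := ℝ) (M := g) (M₂ := Module.Dual ℝ g)) X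
  obtain ⟨u, hu, v, hv, rfl⟩ :=
    Submodule.mem_sup.1 (𝒥.eigenspace_sup_eigenspace_neg_eq_top.ge (Submodule.mem_top (x := w)))
  rw [map_add]
  refine Submodule.add_mem_sup (mem_E hu) (mem_conjSubalgebra.2 ?_)
  have hv' := complexConj_mem_eigenspace hv
  rw [map_neg, Complex.conj_I, neg_neg] at hv'
  rw [complexConj_baseChange]
  exact mem_E hv'

lemma type_eq_finrank_dualAnnihilator (𝒥 : GeneralizedComplexStructure g) :
    𝒥.type = Module.finrank ℂ 𝒥.E.toSubmodule.dualAnnihilator :=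
  Subspace.dual_finrank_eq.symm.trans 𝒥.E.toSubmodule.dualQuotEquivDualAnnihilator.finrank_eq

lemma isAssociated_of_span_eq [FiniteDimensional ℝ g] {𝒥 : GeneralizedComplexStructure g} {k : ℕ}
    {θ : Fin k → CxForm g} (hθ : LinearIndependent ℂ θ)
    (hspan : Submodule.span ℂ (Set.range θ) = 𝒥.E.toSubmodule.dualAnnihilator) :
    𝒥.IsAssociated θ := by
  obtain ⟨σ, hσ, hL⟩ := exists_spinorAnnihilator_ιMulti_mul_exp_eq 𝒥.orthogonal_L hθ hspan
  obtain ⟨B, hB, ω, hω, rfl⟩ := exists_formsToCx_add_I_smul hσ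
  exact ⟨B, hB, ω, hω, hL⟩

lemma IsAssociated.mem_dualAnnihilator {𝒥 : GeneralizedComplexStructure g} {k : ℕ}
    {θ : Fin k → CxForm g} (h : 𝒥.IsAssociated θ) (j : Fin k) :
    θ j ∈ 𝒥.E.toSubmodule.dualAnnihilator := by
  obtain ⟨B, -, ω, -, hL⟩ := h
  refine (zero_mk_mem_iff_of_orthogonal_eq_self 𝒥.orthogonal_L (θ j)).1 ?_
  rw [← hL, spinorAnnihilator, LinearMap.mem_ker, clifford_apply, map_zero, interiorProduct,
    map_zero, LinearMap.zero_apply, zero_add, ← mul_assoc,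
    ι_mul_ιMulti_eq_zero (Submodule.subset_span ⟨j, rfl⟩), zero_mul]

lemma IsAssociated.linearIndependent [Nontrivial g] {𝒥 : GeneralizedComplexStructure g} {k : ℕ}
    {θ : Fin k → CxForm g} (h : 𝒥.IsAssociated θ) : LinearIndependent ℂ θ := by
  by_contra hθ
  obtain ⟨B, -, ω, -, hL⟩ := h
  have L_eq_top : 𝒥.L = ⊤ := by
    rw [← hL, AlternatingMap.map_linearDependent _ _ hθ, zero_mul, eq_top_iff]
    intro u _
    rw [spinorAnnihilator, LinearMap.mem_ker, clifford_apply, map_zero, mul_zero, add_zero]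
  obtain ⟨X, hX⟩ := exists_ne (0 : Cx g)
  have mem_orthogonal : (X, (0 : CxForm g)) ∈ (naturalPairing ℂ (Cx g)).orthogonal 𝒥.L := by
    rw [𝒥.orthogonal_L, L_eq_top]
    trivial
  have eq_zero : (X, (0 : CxForm g)) = 0 := naturalPairing_separatingLeft _ fun u =>
    naturalPairing_isSymm.isRefl _ _ (mem_orthogonal u (L_eq_top ▸ Submodule.mem_top))
  exact hX (congrArg Prod.fst eq_zero)

end GeneralizedComplexStructure

section LowerCentralSeries

variable {R h : Type*} [CommRing R] [LieRing h] [LieAlgebra R h]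

variable (R h) in
/-- The descending central series `h⁰ = h`, `hⁱ⁺¹ = [h, hⁱ]` of a Lie algebra over any ring, as
submodules of `h`; over `ℝ` it is `centralSeries`. -/
def lcs (i : ℕ) : Submodule R h := (LieModule.lowerCentralSeries R h h i).toSubmodule

lemma lcs_zero : lcs R h 0 = ⊤ := by
  rw [lcs, LieModule.lowerCentralSeries_zero, LieSubmodule.top_toSubmodule]

lemma lcs_antitone : Antitone (lcs R h) := fun _ _ hij =>
  LieModule.antitone_lowerCentralSeries R h h hij

lemma lie_mem_lcs_succ (X : h) {Y : h} {i : ℕ} (hY : Y ∈ lcs R h i) : ⁅X, Y⁆ ∈ lcs R h (i + 1) := by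
  rw [lcs, LieModule.lowerCentralSeries_succ]
  exact LieSubmodule.lie_mem_lie (LieSubmodule.mem_top X) hY

lemma lcs_succ_le {P : Submodule R h} {i : ℕ} (hP : ∀ X : h, ∀ Y ∈ lcs R h i, ⁅X, Y⁆ ∈ P) :
    lcs R h (i + 1) ≤ P := by
  rw [lcs, LieModule.lowerCentralSeries_succ, LieSubmodule.lieIdeal_oper_eq_linear_span',
    Submodule.span_le]
  rintro _ ⟨X, -, Y, hY, rfl⟩
  exact hP X Y hY

variable (R h) in
lemma exists_lcs_eq_bot [LieRing.IsNilpotent h] : ∃ i, lcs R h i = ⊥ := by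
  obtain ⟨i, hi⟩ := (LieModule.isNilpotent_iff R h h).1 inferInstance
  exact ⟨i, by rw [lcs, hi, LieSubmodule.bot_toSubmodule]⟩

lemma sup_lcs_succ_eq_top {E : LieSubalgebra R h} (hE : E.toSubmodule ⊔ lcs R h 1 = ⊤) (i : ℕ) :
    E.toSubmodule ⊔ lcs R h (i + 1) = ⊤ := by
  induction i with
  | zero => exact hE
  | succ i ih =>
    refine top_le_iff.1 (hE.ge.trans (sup_le le_sup_left (lcs_succ_le fun X Y _ => ?_)))
    obtain ⟨e, he, v, hv, rfl⟩ := Submodule.mem_sup.1 (ih.ge (Submodule.mem_top (x := X)))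
    obtain ⟨e', he', v', hv', rfl⟩ := Submodule.mem_sup.1 (ih.ge (Submodule.mem_top (x := Y)))
    rw [add_lie, lie_add, add_assoc ⁅e, e'⁆, ← lie_skew v]
    exact Submodule.add_mem_sup (E.lie_mem he he')
      (add_mem (lie_mem_lcs_succ e hv') (neg_mem (lie_mem_lcs_succ _ hv)))

lemma toSubmodule_eq_top_of_sup_lcs_one_eq_top [LieRing.IsNilpotent h] {E : LieSubalgebra R h}
    (hE : E.toSubmodule ⊔ lcs R h 1 = ⊤) : E.toSubmodule = ⊤ := by
  obtain ⟨i, hi⟩ := exists_lcs_eq_bot R h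
  have h_bot : lcs R h (i + 1) = ⊥ := le_bot_iff.1 ((lcs_antitone i.le_succ).trans hi.le)
  simpa only [h_bot, sup_bot_eq] using sup_lcs_succ_eq_top hE i

lemma lie_mem_inf_lcs_sup {E : LieSubalgebra R h} {i : ℕ}
    (hi : lcs R h i ≤ E.toSubmodule ⊔ lcs R h (i + 1)) {X Y : h} (hX : X ∈ E)
    (hY : Y ∈ lcs R h i) :
    ⁅X, Y⁆ ∈ E.toSubmodule ⊓ lcs R h (i + 1) ⊔ lcs R h (i + 2) := by
  obtain ⟨u, hu, v, hv, rfl⟩ := Submodule.mem_sup.1 (hi hY)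
  have hu' : u ∈ lcs R h i := by simpa using sub_mem hY (lcs_antitone i.le_succ hv)
  rw [lie_add]
  exact Submodule.add_mem_sup ⟨E.lie_mem hX hu, lie_mem_lcs_succ X hu'⟩ (lie_mem_lcs_succ X hv)

lemma lcs_succ_le_inf_sup_inf_sup {E E' : LieSubalgebra R h}
    (hEE' : E.toSubmodule ⊔ E'.toSubmodule = ⊤) {i : ℕ}
    (hE : lcs R h i ≤ E.toSubmodule ⊔ lcs R h (i + 1))
    (hE' : lcs R h i ≤ E'.toSubmodule ⊔ lcs R h (i + 1)) :
    lcs R h (i + 1) ≤ E.toSubmodule ⊓ lcs R h (i + 1) ⊔ lcs R h (i + 2) ⊔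
      (E'.toSubmodule ⊓ lcs R h (i + 1) ⊔ lcs R h (i + 2)) := by
  refine lcs_succ_le fun X Y hY => ?_
  obtain ⟨e, he, e', he', rfl⟩ := Submodule.mem_sup.1 (hEE'.ge (Submodule.mem_top (x := X)))
  rw [add_lie]
  exact Submodule.add_mem_sup (lie_mem_inf_lcs_sup hE he hY) (lie_mem_inf_lcs_sup hE' he' hY)

lemma le_sup_of_finrank_le_succ {K W : Type*} [Field K] [AddCommGroup W] [Module K W]
    [FiniteDimensional K W] {A B P : Submodule K W} (hAB : A ≤ B)
    (hdim : Module.finrank K B ≤ Module.finrank K A + 1) (hPB : P ≤ B) (hPA : ¬ P ≤ A) :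
    B ≤ P ⊔ A := by
  have hlt : A < P ⊔ A := right_lt_sup.2 hPA
  refine (Submodule.eq_of_le_of_finrank_le (sup_le hPB hAB) ?_).ge
  exact hdim.trans (Submodule.finrank_lt_finrank_of_lt hlt)

lemma lcs_succ_le_sup_or {K : Type*} [Field K] [LieAlgebra K h] [FiniteDimensional K h]
    {E E' : LieSubalgebra K h} (hEE' : E.toSubmodule ⊔ E'.toSubmodule = ⊤) {i : ℕ}
    (hE : lcs K h i ≤ E.toSubmodule ⊔ lcs K h (i + 1))
    (hE' : lcs K h i ≤ E'.toSubmodule ⊔ lcs K h (i + 1))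
    (hdim : Module.finrank K (lcs K h (i + 1)) ≤ Module.finrank K (lcs K h (i + 2)) + 1) :
    lcs K h (i + 1) ≤ E.toSubmodule ⊔ lcs K h (i + 2) ∨
      lcs K h (i + 1) ≤ E'.toSubmodule ⊔ lcs K h (i + 2) := by
  have absorbs {F : LieSubalgebra K h}
      (hF : ¬ F.toSubmodule ⊓ lcs K h (i + 1) ≤ lcs K h (i + 2)) :
      lcs K h (i + 1) ≤ F.toSubmodule ⊔ lcs K h (i + 2) :=
    (le_sup_of_finrank_le_succ (lcs_antitone (i + 1).le_succ) hdim inf_le_right hF).trans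
      (sup_le_sup_right inf_le_left _)
  by_cases hle : E.toSubmodule ⊓ lcs K h (i + 1) ≤ lcs K h (i + 2)
  · by_cases hle' : E'.toSubmodule ⊓ lcs K h (i + 1) ≤ lcs K h (i + 2)
    · exact .inl (((lcs_succ_le_inf_sup_inf_sup hEE' hE hE').trans
        (sup_le (sup_le hle le_rfl) (sup_le hle' le_rfl))).trans le_sup_right)
    · exact .inr (absorbs hle')
  · exact .inl (absorbs hle)

end LowerCentralSeries

section Complexification

variable {g : Type*} [LieRing g] [LieAlgebra ℝ g]

lemma lcs_complexification (i : ℕ) : lcs ℂ (Cx g) i = (centralSeries g i).baseChange ℂ := by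
  rw [lcs, LieSubmodule.lowerCentralSeries_tensor_eq_baseChange]
  rfl

lemma finrank_lcs_complexification (i : ℕ) :
    Module.finrank ℂ (lcs ℂ (Cx g) i) = Module.finrank ℝ (centralSeries g i) := by
  rw [lcs_complexification, ← Module.finrank_baseChange (R := ℂ) (S := ℝ)]
  exact (LinearEquiv.ofBijective ((centralSeries g i).toBaseChange ℂ)
    ⟨Submodule.toBaseChange_injective .., Submodule.toBaseChange_surjective ℂ _⟩).finrank_eq.symm

lemma complexConj_mem_lcs {X : Cx g} {i : ℕ} (hX : X ∈ lcs ℂ (Cx g) i) :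
    complexConj g X ∈ lcs ℂ (Cx g) i := by
  rw [lcs_complexification] at hX ⊢
  exact complexConj_mem_baseChange _ hX

lemma lcs_le_conjSubalgebra_sup {F : LieSubalgebra ℂ (Cx g)} {i j : ℕ}
    (hF : lcs ℂ (Cx g) i ≤ F.toSubmodule ⊔ lcs ℂ (Cx g) j) :
    lcs ℂ (Cx g) i ≤ (conjSubalgebra F).toSubmodule ⊔ lcs ℂ (Cx g) j := by
  intro X hX
  obtain ⟨u, hu, v, hv, huv⟩ := Submodule.mem_sup.1 (hF (complexConj_mem_lcs hX))
  rw [← complexConj_complexConj X, ← huv, map_add]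
  refine Submodule.add_mem_sup (mem_conjSubalgebra.2 ?_) (complexConj_mem_lcs hv)
  rwa [complexConj_complexConj]

lemma lcs_succ_le_sup [FiniteDimensional ℝ g] {F : LieSubalgebra ℂ (Cx g)}
    (hF : F.toSubmodule ⊔ (conjSubalgebra F).toSubmodule = ⊤) {i : ℕ}
    (hi : lcs ℂ (Cx g) i ≤ F.toSubmodule ⊔ lcs ℂ (Cx g) (i + 1))
    (hdim : Module.finrank ℝ (centralSeries g (i + 1)) ≤
      Module.finrank ℝ (centralSeries g (i + 2)) + 1) :
    lcs ℂ (Cx g) (i + 1) ≤ F.toSubmodule ⊔ lcs ℂ (Cx g) (i + 2) := by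
  simp only [← finrank_lcs_complexification] at hdim
  rcases lcs_succ_le_sup_or hF hi (lcs_le_conjSubalgebra_sup hi) hdim with h | h
  · exact h
  · simpa only [conjSubalgebra_conjSubalgebra] using lcs_le_conjSubalgebra_sup h

lemma span_formToCx_image_dualAnnihilator (P : Submodule ℝ g) :
    Submodule.span ℂ (formToCx g '' P.dualAnnihilator) = (P.baseChange ℂ).dualAnnihilator := by
  refine le_antisymm (Submodule.span_le.2 ?_) fun θ hθ => ?_
  · rintro _ ⟨α, hα, rfl⟩
    have hker : P.baseChange ℂ ≤ LinearMap.ker (formToCx g α) := by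
      rw [Submodule.baseChange_eq_span, Submodule.span_le]
      rintro _ ⟨x, hx, rfl⟩
      simp [formToCx_tmul, (Submodule.mem_dualAnnihilator α).1 hα x hx]
    exact (Submodule.mem_dualAnnihilator _).2 hker
  · obtain ⟨α, β, rfl⟩ := exists_formToCx_add_I_smul θ
    have eval_eq_zero {x : g} (hx : x ∈ P) : (α x : ℂ) + Complex.I * (β x : ℂ) = 0 := by
      simpa [formToCx_tmul] using
        (Submodule.mem_dualAnnihilator _).1 hθ _ (Submodule.tmul_mem_baseChange_of_mem 1 hx)
    refine add_mem (Submodule.subset_span ⟨α, ?_, rfl⟩)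
      (Submodule.smul_mem _ _ (Submodule.subset_span ⟨β, ?_, rfl⟩)) <;>
      refine (Submodule.mem_dualAnnihilator _).2 fun x hx => ?_
    · simpa using congrArg Complex.re (eval_eq_zero hx)
    · simpa using congrArg Complex.im (eval_eq_zero hx)

lemma V_eq_dualAnnihilator_lcs (i : ℕ) : V g i = (lcs ℂ (Cx g) i).dualAnnihilator := by
  rw [V, span_formToCx_image_dualAnnihilator, lcs_complexification]

lemma V_mono : Monotone (V g) := fun i j hij => by
  simpa only [V_eq_dualAnnihilator_lcs] using Submodule.dualAnnihilator_anti (lcs_antitone hij)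

lemma V_zero : V g 0 = ⊥ := by
  rw [V_eq_dualAnnihilator_lcs, lcs_zero, Submodule.dualAnnihilator_top]

variable (g) in
lemma exists_V_eq_top [LieRing.IsNilpotent g] : ∃ i, V g i = ⊤ := by
  obtain ⟨i, hi⟩ := exists_lcs_eq_bot ℂ (Cx g)
  exact ⟨i, by rw [V_eq_dualAnnihilator_lcs, hi, Submodule.dualAnnihilator_bot]⟩

lemma nilDegree_le_iff [LieRing.IsNilpotent g] {θ : CxForm g} {i : ℕ} :
    nilDegree θ ≤ i ↔ θ ∈ V g i := by
  obtain ⟨m, hm⟩ := exists_V_eq_top g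
  have hne : {i : ℕ | θ ∈ V g i}.Nonempty := ⟨m, hm.ge Submodule.mem_top⟩
  exact ⟨fun h => V_mono h (Nat.sInf_mem hne), fun h => Nat.sInf_le h⟩

end Complexification

section AdaptedFamilies

variable {K W : Type*} [Field K] [AddCommGroup W] [Module K W]

lemma linearIndependent_mkQ_of_span_inf_le {ι : Type*} {f : ι → W} (hf : LinearIndependent K f)
    {p : ι → Prop} {U : Submodule K W}
    (hU : Submodule.span K (Set.range f) ⊓ U ≤ Submodule.span K (f '' {j | ¬ p j})) :
    LinearIndependent K fun j : {j // p j} => U.mkQ (f j) := by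
  have range_eq : Set.range (fun j : {j // p j} => f j) = f '' {j | p j} :=
    (Set.image_eq_range f {j | p j}).symm
  have hdisj : Disjoint (Submodule.span K (f '' {j | p j})) (Submodule.span K (f '' {j | ¬ p j})) :=
    hf.disjoint_span_image (Set.disjoint_left.2 fun _ hj hj' => hj' hj)
  refine (hf.comp _ Subtype.val_injective).map (f := U.mkQ) ?_
  rw [Submodule.ker_mkQ, Function.comp_def, range_eq, Submodule.disjoint_def]
  exact fun w hw hwU => Submodule.disjoint_def.1 hdisj w hw
    (hU ⟨Submodule.span_mono (Set.image_subset_range _ _) hw, hwU⟩)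

variable [FiniteDimensional K W] {F : ℕ → Submodule K W} {a : ℕ → ℕ}

lemma exists_linearIndependent_forall_mem {k : ℕ} (h : ∀ j < k, j < Module.finrank K (F (a j))) :
    ∃ f : Fin k → W, LinearIndependent K f ∧ ∀ j : Fin k, f j ∈ F (a j) := by
  induction k with
  | zero => exact ⟨Fin.elim0, linearIndependent_empty_type, fun j => j.elim0⟩
  | succ k ih =>
    obtain ⟨f, hf, hfF⟩ := ih fun j hj => h j (hj.trans k.lt_succ_self)
    have hspan : Module.finrank K (Submodule.span K (Set.range f)) <
        Module.finrank K (F (a k)) := by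
      rw [finrank_span_eq_card hf, Fintype.card_fin]
      exact h k k.lt_succ_self
    obtain ⟨v, hv, hvf⟩ := SetLike.not_le_iff_exists.1 fun hle =>
      (Submodule.finrank_mono hle).not_gt hspan
    refine ⟨Fin.snoc f v, linearIndependent_finSnoc.2 ⟨hf, hvf⟩, Fin.lastCases ?_ fun j => ?_⟩
    · simpa using hv
    · simpa using hfF j

theorem exists_adapted_family (hF : Monotone F) {k : ℕ} (hk : ∀ i, Module.finrank K (F i) ≤ k)
    (ha : ∀ j < k, ∀ i, j < Module.finrank K (F i) ↔ a j ≤ i) :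
    ∃ f : Fin k → W, LinearIndependent K f ∧ (∀ j i, f j ∈ F i ↔ a j ≤ i) ∧
      ∀ i, Submodule.span K (f '' {j | a j ≤ i}) = F i := by
  obtain ⟨f, hf, hfF⟩ :=
    exists_linearIndependent_forall_mem (F := F) fun j hj => (ha j hj _).2 le_rfl
  have mem_of_le {j : Fin k} {i : ℕ} (h : a j ≤ i) : f j ∈ F i := hF h (hfF j)
  have span_eq (i : ℕ) : Submodule.span K (f '' {j | a j ≤ i}) = F i := by
    let c := Fin.castLE (hk i)
    refine Submodule.eq_of_le_of_finrank_le (Submodule.span_le.2 ?_) ?_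
    · rintro _ ⟨j, hj, rfl⟩
      exact mem_of_le hj
    · calc Module.finrank K (F i) = Module.finrank K (Submodule.span K (Set.range (f ∘ c))) := by
            rw [finrank_span_eq_card (hf.comp c (Fin.castLE_injective _)), Fintype.card_fin]
        _ ≤ _ := by
            refine Submodule.finrank_mono (Submodule.span_mono ?_)
            rintro _ ⟨j, rfl⟩
            exact ⟨c j, (ha _ (c j).2 i).1 j.2, rfl⟩
  refine ⟨f, hf, fun j i => ⟨fun h => ?_, mem_of_le⟩, span_eq⟩
  by_contra hj
  exact hf.notMem_span_image (s := {j | a j ≤ i}) hj (by rwa [span_eq])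

end AdaptedFamilies

section AnnihilatorFiltration

variable {g : Type*} [LieRing g] [LieAlgebra ℝ g]

/-- The forms of nilpotency degree at most `i` that vanish on a subalgebra `F` of the
complexification of `g`. For `F` the projection of `L`, these filter the span of the 1-forms
associated with the generalized complex structure. -/
def annFiltration (F : LieSubalgebra ℂ (Cx g)) (i : ℕ) : Submodule ℂ (CxForm g) :=
  F.toSubmodule.dualAnnihilator ⊓ V g i

variable {F : LieSubalgebra ℂ (Cx g)}

lemma annFiltration_mono : Monotone (annFiltration F) := fun _ _ h => inf_le_inf_left _ (V_mono h)

lemma annFiltration_zero : annFiltration F 0 = ⊥ := by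
  rw [annFiltration, V_zero, inf_bot_eq]

lemma annFiltration_eq_dualAnnihilator (i : ℕ) :
    annFiltration F i = (F.toSubmodule ⊔ lcs ℂ (Cx g) i).dualAnnihilator := by
  rw [annFiltration, V_eq_dualAnnihilator_lcs, Submodule.dualAnnihilator_sup_eq]

variable (F) in
lemma exists_annFiltration_eq [LieRing.IsNilpotent g] :
    ∃ i, annFiltration F i = F.toSubmodule.dualAnnihilator := by
  obtain ⟨i, hi⟩ := exists_V_eq_top g
  exact ⟨i, by rw [annFiltration, hi, inf_top_eq]⟩

lemma annFiltration_eq_bot_of_one_eq_bot [LieRing.IsNilpotent g] (h : annFiltration F 1 = ⊥)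
    (i : ℕ) : annFiltration F i = ⊥ := by
  rw [annFiltration_eq_dualAnnihilator, ← Submodule.dualAnnihilator_top,
    Subspace.dualAnnihilator_inj] at h
  rw [annFiltration, toSubmodule_eq_top_of_sup_lcs_one_eq_top h, Submodule.dualAnnihilator_top,
    bot_inf_eq]

lemma annFiltration_succ_eq_iff {i : ℕ} : annFiltration F (i + 1) = annFiltration F i ↔
    lcs ℂ (Cx g) i ≤ F.toSubmodule ⊔ lcs ℂ (Cx g) (i + 1) := by
  rw [annFiltration_eq_dualAnnihilator, annFiltration_eq_dualAnnihilator,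
    Subspace.dualAnnihilator_inj]
  exact ⟨fun h => h ▸ le_sup_right, fun h => le_antisymm
    (sup_le_sup_left (lcs_antitone i.le_succ) _) (sup_le le_sup_left h)⟩

variable [FiniteDimensional ℝ g]

lemma finrank_annFiltration_add (i : ℕ) : Module.finrank ℂ (annFiltration F i) +
    Module.finrank ℂ ↥(F.toSubmodule ⊔ lcs ℂ (Cx g) i) = Module.finrank ℝ g := by
  rw [annFiltration_eq_dualAnnihilator, add_comm,
    Subspace.finrank_add_finrank_dualAnnihilator_eq, Module.finrank_baseChange]

lemma finrank_sup_add_finrank_le {K W : Type*} [Field K] [AddCommGroup W] [Module K W]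
    [FiniteDimensional K W] (P : Submodule K W) {A B : Submodule K W} (h : A ≤ B) :
    Module.finrank K ↥(P ⊔ B) + Module.finrank K A ≤
      Module.finrank K ↥(P ⊔ A) + Module.finrank K B := by
  rw [← Submodule.finrank_sup_add_finrank_inf_eq (P ⊔ A) B, sup_assoc, sup_eq_right.2 h]
  exact Nat.add_le_add_left (Submodule.finrank_mono (le_inf le_sup_right h)) _

lemma finrank_annFiltration_succ_add_le (i : ℕ) :
    Module.finrank ℂ (annFiltration F (i + 1)) + Module.finrank ℝ (centralSeries g (i + 1)) ≤
      Module.finrank ℂ (annFiltration F i) + Module.finrank ℝ (centralSeries g i) := by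
  have h := finrank_sup_add_finrank_le F.toSubmodule
    (lcs_antitone (R := ℂ) (h := Cx g) (Nat.le_add_right i 1))
  simp only [finrank_lcs_complexification] at h
  have hi := finrank_annFiltration_add (F := F) i
  have hi' := finrank_annFiltration_add (F := F) (i + 1)
  omega

lemma annFiltration_succ_succ_eq (hF : F.toSubmodule ⊔ (conjSubalgebra F).toSubmodule = ⊤) {i : ℕ}
    (hdim : Module.finrank ℝ (centralSeries g (i + 1)) ≤
      Module.finrank ℝ (centralSeries g (i + 2)) + 1)
    (h : annFiltration F (i + 1) = annFiltration F i) :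
    annFiltration F (i + 2) = annFiltration F (i + 1) :=
  annFiltration_succ_eq_iff.2 (lcs_succ_le_sup hF (annFiltration_succ_eq_iff.1 h) hdim)

lemma two_mul_finrank_annFiltration_add_le
    (hF : F.toSubmodule ⊔ (conjSubalgebra F).toSubmodule = ⊤) (i : ℕ) :
    2 * Module.finrank ℂ (annFiltration F i) + Module.finrank ℝ (centralSeries g i) ≤
      Module.finrank ℝ g := by
  have hle : Module.finrank ℝ g + Module.finrank ℂ (lcs ℂ (Cx g) i) ≤
      2 * Module.finrank ℂ ↥(F.toSubmodule ⊔ lcs ℂ (Cx g) i) :=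
    finrank_add_finrank_le_two_mul
      (top_le_iff.1 (hF.ge.trans (sup_le_sup le_sup_left (Submodule.comap_mono le_sup_left))))
      fun X hX => ⟨Submodule.mem_sup_right hX, Submodule.mem_sup_right (complexConj_mem_lcs hX)⟩
  rw [finrank_lcs_complexification] at hle
  have hdim := finrank_annFiltration_add (F := F) i
  omega

end AnnihilatorFiltration

section Degrees

variable {d : ℕ → ℕ} {k r s : ℕ}

lemma eq_of_succ_eq (hd : Monotone d) (hle : ∀ i, d i ≤ k) (hk : ∃ i, d i = k)
    (hstat : ∀ i ≥ s, d (i + 1) = d i → d (i + 2) = d (i + 1)) (hs : d (s + 1) = d s) :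
    d s = k := by
  have succ_eq (i : ℕ) (hi : s ≤ i) : d (i + 1) = d i := Nat.le_induction hs hstat i hi
  have const (i : ℕ) (hi : s ≤ i) : d i = d s :=
    Nat.le_induction rfl (fun j hj ih => (succ_eq j hj).trans ih) i hi
  obtain ⟨m, hm⟩ := hk
  refine le_antisymm (hle s) ?_
  rw [← hm, ← const (max s m) (le_max_left s m)]
  exact hd (le_max_right s m)

lemma eq_min_add (hd : Monotone d) (hle : ∀ i, d i ≤ k) (hk : ∃ i, d i = k)
    (hstep : ∀ i ≥ s, d (i + 1) ≤ d i + 1)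
    (hstat : ∀ i ≥ s, d (i + 1) = d i → d (i + 2) = d (i + 1)) (t : ℕ) :
    d (s + t) = min k (d s + t) := by
  induction t with
  | zero => exact (min_eq_right (hle s)).symm
  | succ t ih =>
    have hst : s ≤ s + t := Nat.le_add_right s t
    have h_mono := hd (Nat.le_add_right (s + t) 1)
    have h_step := hstep (s + t) hst
    have h_le := hle (s + t + 1)
    have h_eq := eq_of_succ_eq hd hle hk fun i hi => hstat i (hst.trans hi)
    rw [← add_assoc]
    omega

lemma eq_one_of_lt (hd : Monotone d) (hd1 : 1 ≤ d 1) (hd2 : d 2 ≤ 1)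
    (hstat : ∀ i, i + 2 ≠ r → d (i + 1) = d i → d (i + 2) = d (i + 1)) {i : ℕ} (hi : 1 ≤ i)
    (hir : i < r) : d i = 1 := by
  have h12 : d 1 ≤ d 2 := hd one_le_two
  induction i using Nat.strong_induction_on with
  | _ i ih =>
    match i with
    | 1 => omega
    | 2 => omega
    | i + 3 =>
      have h1 := ih (i + 1) (by omega) (by omega) (by omega)
      have h2 := ih (i + 2) (by omega) (by omega) (by omega)
      rw [hstat (i + 1) hir.ne (h2.trans h1.symm), h2]

lemma lt_iff_firstDegrees_le (hr : 1 ≤ r) (hd0 : d 0 = 0)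
    (h_low : ∀ i, 1 ≤ i → i < r → d i = 1) (h_high : ∀ t, d (r + t) = min k (2 + t)) {j : ℕ}
    (hj : j < k) (i : ℕ) : j < d i ↔ firstDegrees r j ≤ i := by
  rcases i.eq_zero_or_pos with rfl | hi
  · cases j <;> simp only [firstDegrees] <;> omega
  rcases lt_or_ge i r with hir | hir
  · rw [h_low i hi hir]
    cases j <;> simp only [firstDegrees] <;> omega
  · obtain ⟨t, rfl⟩ := Nat.exists_eq_add_of_le hir
    rw [h_high]
    cases j <;> simp only [firstDegrees] <;> omega

lemma lt_iff_secondDegrees_le (hr : 1 ≤ r) (hd0 : d 0 = 0)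
    (h_low : ∀ i, 1 ≤ i → i < r → d i = 1) (h_high : ∀ t, d (r + t) = min k (3 + t)) {j : ℕ}
    (hj : j < k) (i : ℕ) : j < d i ↔ secondDegrees r j ≤ i := by
  rcases i.eq_zero_or_pos with rfl | hi
  · obtain _ | _ | j := j <;> simp only [secondDegrees] <;> omega
  rcases lt_or_ge i r with hir | hir
  · rw [h_low i hi hir]
    obtain _ | _ | j := j <;> simp only [secondDegrees] <;> omega
  · obtain ⟨t, rfl⟩ := Nat.exists_eq_add_of_le hir
    rw [h_high]
    obtain _ | _ | j := j <;> simp only [secondDegrees] <;> omega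

theorem exists_degrees (hr : 3 ≤ r) (hd : Monotone d) (hd0 : d 0 = 0)
    (hd1 : d 1 = 0 → ∀ i, d i = 0) (hd2 : d 2 ≤ 1) (hle : ∀ i, d i ≤ k) (hk : ∃ i, d i = k)
    (hstep : ∀ i, d (i + 1) ≤ d i + if i + 1 = 1 ∨ i + 1 = r then 2 else 1)
    (hstat : ∀ i, i + 2 ≠ r → d (i + 1) = d i → d (i + 2) = d (i + 1)) :
    ∃ a : ℕ → ℕ, (a = firstDegrees r ∨ a = secondDegrees r) ∧ ∀ j < k, ∀ i, j < d i ↔ a j ≤ i := by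
  rcases (d 1).eq_zero_or_pos with h1 | h1
  · obtain ⟨m, rfl⟩ := hk
    exact ⟨firstDegrees r, .inl rfl, fun j hj => by simp [hd1 h1 m] at hj⟩
  have h_low (i : ℕ) (hi : 1 ≤ i) (hir : i < r) : d i = 1 := eq_one_of_lt hd h1 hd2 hstat hi hir
  have h_high (t : ℕ) : d (r + t) = min k (d r + t) :=
    eq_min_add hd hle hk (fun i hi => by have := hstep i; rwa [if_neg (by omega)] at this)
      (fun i hi => hstat i (by omega)) t
  have h_pred : d (r - 1) = 1 := h_low _ (by omega) (by omega)
  have h_succ : r - 1 + 1 = r := by omega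
  have one_le : 1 ≤ d r := h_pred.ge.trans (hd r.pred_le)
  have le_three : d r ≤ 3 := by simpa [h_pred, h_succ] using hstep (r - 1)
  obtain h | h | h : d r = 1 ∨ d r = 2 ∨ d r = 3 := by omega
  · have k_eq : d (r - 1) = k := eq_of_succ_eq hd hle hk (fun i hi => hstat i (by omega))
      (by rw [h_succ, h, h_pred])
    exact ⟨_, .inl rfl, fun j hj => lt_iff_firstDegrees_le (by omega) hd0 h_low
      (fun t => by rw [h_high]; omega) hj⟩
  · exact ⟨_, .inl rfl, fun j hj => lt_iff_firstDegrees_le (by omega) hd0 h_low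
      (fun t => by rw [h_high, h]) hj⟩
  · exact ⟨_, .inr rfl, fun j hj => lt_iff_secondDegrees_le (by omega) hd0 h_low
      (fun t => by rw [h_high, h]) hj⟩

lemma secondDegrees_mono (hr : 1 ≤ r) : Monotone (secondDegrees r) :=
  monotone_nat_of_le_succ fun i => by
    obtain _ | _ | i := i <;> simp only [secondDegrees] <;> omega

end Degrees

section Dimensions

variable {g : Type*} [LieRing g] [LieAlgebra ℝ g]

lemma finrank_centralSeries_zero : Module.finrank ℝ (centralSeries g 0) = Module.finrank ℝ g := by
  rw [centralSeries, LieModule.lowerCentralSeries_zero, LieSubmodule.top_toSubmodule, finrank_top]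

lemma centralSeries_nilindex [LieRing.IsNilpotent g] : centralSeries g (nilindex g) = ⊥ :=
  Nat.sInf_mem (s := {m : ℕ | centralSeries g m = ⊥}) (exists_lcs_eq_bot ℝ g)

variable [FiniteDimensional ℝ g]

lemma finrank_centralSeries_eq_succ_add (i : ℕ) :
    Module.finrank ℝ (centralSeries g i) =
      Module.finrank ℝ (centralSeries g (i + 1)) + gradedDim g i := by
  have hle : centralSeries g (i + 1) ≤ centralSeries g i := lcs_antitone i.le_succ
  rw [gradedDim, ← (Submodule.submoduleOfEquivOfLe hle).finrank_eq, add_comm,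
    Submodule.finrank_quotient_add_finrank]

lemma finrank_centralSeries_le_succ_add [LieRing.IsNilpotent g] {r : ℕ} (hform : IsOfFormT g r)
    (i : ℕ) : Module.finrank ℝ (centralSeries g i) ≤
      Module.finrank ℝ (centralSeries g (i + 1)) + if i + 1 = 1 ∨ i + 1 = r then 2 else 1 := by
  rcases lt_or_ge i (nilindex g) with hi | hi
  · rw [finrank_centralSeries_eq_succ_add, hform.2.2 i hi]
  · have h_bot : centralSeries g i = ⊥ :=
      le_bot_iff.1 ((lcs_antitone hi).trans centralSeries_nilindex.le)
    rw [h_bot, finrank_bot]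
    exact Nat.zero_le _

lemma finrank_le_finrank_centralSeries_add [LieRing.IsNilpotent g] {r : ℕ}
    (hform : IsOfFormT g r) (i : ℕ) :
    Module.finrank ℝ g ≤ Module.finrank ℝ (centralSeries g i) + i + if i < r then 1 else 2 := by
  have hr : 2 ≤ r := hform.1
  induction i with
  | zero => rw [finrank_centralSeries_zero]; omega
  | succ i ih =>
    have hi := finrank_centralSeries_le_succ_add hform i
    rcases i.eq_zero_or_pos with rfl | hi0
    · rw [finrank_centralSeries_zero] at hi
      split_ifs at * <;> omega
    · split_ifs at * <;> omega

end Dimensions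

lemma isAppropriate_of_span_inf_le {g : Type*} [LieRing g] [LieAlgebra ℝ g] {k : ℕ}
    {θ : Fin k → CxForm g} (hθ : LinearIndependent ℂ θ)
    (hmono : Monotone fun j => nilDegree (θ j))
    (hspan : ∀ i, Submodule.span ℂ (Set.range θ) ⊓ V g i ≤
      Submodule.span ℂ (θ '' {j | nilDegree (θ j) ≤ i})) : IsAppropriate θ :=
  ⟨fun _ _ hij => hmono hij.le, fun i => linearIndependent_mkQ_of_span_inf_le hθ
    (by simpa only [not_lt] using hspan i)⟩

namespace GeneralizedComplexStructure

variable {g : Type*} [LieRing g] [LieAlgebra ℝ g] {𝒥 : GeneralizedComplexStructure g}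

variable (𝒥) in
lemma exists_finrank_annFiltration_E_eq_type [LieRing.IsNilpotent g] :
    ∃ i, Module.finrank ℂ (annFiltration 𝒥.E i) = 𝒥.type := by
  obtain ⟨i, hi⟩ := exists_annFiltration_eq 𝒥.E
  exact ⟨i, by rw [hi, type_eq_finrank_dualAnnihilator]⟩

variable [FiniteDimensional ℝ g]

lemma finrank_annFiltration_E_le_type (i : ℕ) :
    Module.finrank ℂ (annFiltration 𝒥.E i) ≤ 𝒥.type := by
  rw [type_eq_finrank_dualAnnihilator]
  exact Submodule.finrank_mono inf_le_left

variable [LieRing.IsNilpotent g]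

theorem exists_isAssociated_isAppropriate {a : ℕ → ℕ}
    (ha : ∀ j < 𝒥.type, ∀ i, j < Module.finrank ℂ (annFiltration 𝒥.E i) ↔ a j ≤ i) :
    ∃ θ : Fin 𝒥.type → CxForm g, 𝒥.IsAssociated θ ∧ IsAppropriate θ ∧
      ∀ j : Fin 𝒥.type, nilDegree (θ j) = a j := by
  obtain ⟨θ, hθ, mem_iff, span_eq⟩ :=
    exists_adapted_family annFiltration_mono 𝒥.finrank_annFiltration_E_le_type ha
  obtain ⟨m, hm⟩ := exists_annFiltration_eq 𝒥.E
  have hE (j : Fin 𝒥.type) : θ j ∈ 𝒥.E.toSubmodule.dualAnnihilator :=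
    ((mem_iff j (a j)).2 le_rfl).1
  have hspan : Submodule.span ℂ (Set.range θ) = 𝒥.E.toSubmodule.dualAnnihilator := by
    refine le_antisymm (Submodule.span_le.2 (Set.range_subset_iff.2 hE)) ?_
    rw [← hm, ← span_eq]
    exact Submodule.span_mono (Set.image_subset_range _ _)
  have nilDegree_eq (j : Fin 𝒥.type) : nilDegree (θ j) = a j :=
    eq_of_forall_ge_iff fun i => by
      rw [nilDegree_le_iff, ← mem_iff]
      exact ⟨fun h => ⟨hE j, h⟩, fun h => h.2⟩
  have a_mono {i j : Fin 𝒥.type} (hij : i ≤ j) : a i ≤ a j :=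
    (ha i i.2 _).1 (lt_of_le_of_lt hij ((ha j j.2 _).2 le_rfl))
  refine ⟨θ, 𝒥.isAssociated_of_span_eq hθ hspan,
    isAppropriate_of_span_inf_le hθ (fun i j hij => ?_) fun i => ?_, nilDegree_eq⟩
  · simpa only [nilDegree_eq] using a_mono hij
  · simp only [nilDegree_eq, hspan, span_eq]
    exact le_rfl

lemma two_mul_finrank_annFiltration_E_le {r : ℕ} (hform : IsOfFormT g r) (i : ℕ) :
    2 * Module.finrank ℂ (annFiltration 𝒥.E i) ≤ i + if i < r then 1 else 2 := by
  have hle := two_mul_finrank_annFiltration_add_le 𝒥.E_sup_conjSubalgebra_E i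
  have hdim := finrank_le_finrank_centralSeries_add hform i
  omega

variable (𝒥) in
theorem exists_jump_degrees {r : ℕ} (hr : 3 ≤ r) (hform : IsOfFormT g r) :
    ∃ a : ℕ → ℕ, (a = firstDegrees r ∨ a = secondDegrees r) ∧
      ∀ j < 𝒥.type, ∀ i, j < Module.finrank ℂ (annFiltration 𝒥.E i) ↔ a j ≤ i := by
  have hdim := finrank_centralSeries_le_succ_add hform
  refine exists_degrees hr (fun i j h => Submodule.finrank_mono (annFiltration_mono h)) ?_ ?_ ?_
    𝒥.finrank_annFiltration_E_le_type 𝒥.exists_finrank_annFiltration_E_eq_type ?_ ?_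
  · rw [annFiltration_zero, finrank_bot]
  · intro h1 i
    rw [annFiltration_eq_bot_of_one_eq_bot (Submodule.finrank_eq_zero.1 h1), finrank_bot]
  · have h2 := 𝒥.two_mul_finrank_annFiltration_E_le hform 2
    rw [if_pos (by omega)] at h2
    omega
  · intro i
    have h_step := finrank_annFiltration_succ_add_le (F := 𝒥.E) i
    have h_dim := hdim i
    omega
  · intro i hir h
    have h_eq : annFiltration 𝒥.E (i + 1) = annFiltration 𝒥.E i :=
      (Submodule.eq_of_le_of_finrank_eq (annFiltration_mono i.le_succ) h.symm).symm
    have h_dim := hdim (i + 1)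
    rw [if_neg (by omega)] at h_dim
    rw [annFiltration_succ_succ_eq 𝒥.E_sup_conjSubalgebra_E h_dim h_eq]

lemma IsAssociated.two_mul_le [Nontrivial g] {r k n : ℕ} (hform : IsOfFormT g r)
    {θ : Fin k → CxForm g} (hθ : 𝒥.IsAssociated θ) (hdeg : ∀ j, nilDegree (θ j) ≤ n) :
    2 * k ≤ n + if n < r then 1 else 2 := by
  have hspan : Submodule.span ℂ (Set.range θ) ≤ annFiltration 𝒥.E n :=
    Submodule.span_le.2 (Set.range_subset_iff.2 fun j =>
      ⟨hθ.mem_dualAnnihilator j, nilDegree_le_iff.1 (hdeg j)⟩)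
  have hle := Submodule.finrank_mono hspan
  rw [finrank_span_eq_card hθ.linearIndependent, Fintype.card_fin] at hle
  have hdim := 𝒥.two_mul_finrank_annFiltration_E_le hform n
  omega

lemma IsAssociated.lt_of_nilDegree_eq_secondDegrees [Nontrivial g] {r k : ℕ} (hr : 3 ≤ r)
    (hform : IsOfFormT g r) {θ : Fin k → CxForm g} (hθ : 𝒥.IsAssociated θ)
    (hdeg : ∀ j : Fin k, nilDegree (θ j) = secondDegrees r j) : k < r := by
  rcases lt_or_ge k 3 with hk | hk
  · omega
  obtain ⟨k, rfl⟩ := Nat.exists_eq_add_of_le' hk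
  have hle := hθ.two_mul_le hform fun j => (hdeg j).trans_le
    (secondDegrees_mono (by omega) (Nat.le_of_lt_succ j.2))
  rw [secondDegrees, if_neg (by omega)] at hle
  omega

end GeneralizedComplexStructure

end GenComplex

end

open GenComplex in
theorem mainTheorem4 {g : Type*} [LieRing g] [LieAlgebra ℝ g] [FiniteDimensional ℝ g]
    (heven : Even (Module.finrank ℝ g)) (hqf : IsQuasiFiliform g)
    (r : ℕ) (hr : 3 ≤ r) (hform : IsOfFormT g r)
    (𝒥 : GeneralizedComplexStructure g) (k : ℕ) (hk : 𝒥.type = k) :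
    (∃ θ : Fin k → CxForm g, 𝒥.IsAssociated θ ∧ IsAppropriate θ ∧
      ((∀ j : Fin k, nilDegree (θ j) = firstDegrees r j) ∨
        (∀ j : Fin k, nilDegree (θ j) = secondDegrees r j))) ∧
    (∀ θ : Fin k → CxForm g, 𝒥.IsAssociated θ →
      (∀ j : Fin k, nilDegree (θ j) = secondDegrees r j) → k < r) := by
  subst hk
  have : LieRing.IsNilpotent g := hqf.1
  have : Nontrivial g := Module.nontrivial_of_finrank_pos (R := ℝ) (hqf.2 ▸ Nat.succ_pos _)
  refine ⟨?_, fun θ hθ hdeg => hθ.lt_of_nilDegree_eq_secondDegrees hr hform hdeg⟩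
  obtain ⟨a, ha, hjump⟩ := 𝒥.exists_jump_degrees hr hform
  obtain ⟨θ, hθ, happ, hdeg⟩ := 𝒥.exists_isAssociated_isAppropriate hjump
  refine ⟨θ, hθ, happ, ?_⟩
  rcases ha with rfl | rfl
  · exact .inl hdeg
  · exact .inr hdeg
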